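/- A square lattice walk is a finite (possibly empty) walk in $\mathbb Z^2$ starting at $(0,0)$ with steps $E=(1,0)$, $N=(0,1)$, $W=(-1,0)$, $S=(0,-1)$; it is a loop if it ends at $(0,0)$. Its ES and NW corners are the pairs of consecutive steps equal to $ES$ or to $NW$. Write $\bar x=1/x$, $\bar y=1/y$. All series are formal power series in $s,t$, and a quotient or a square root stands for the quotient or the square root in the ring of power series (every denominator and every radicand below has constant term $1$, and the square root is the one with constant term $1$). (i) The generating function $\mathcal W(a,s,t;x,y)\in\mathbb Q[a,x,\bar x,y,\bar y][[s,t]]$ counting square lattice walks by the number of horizontal steps ($s$), the number of vertical steps ($t$), the number of ES and NW corners ($a$) and the coordinates of the endpoint ($x,y$) is rational, and $$\mathcal W(a,s,t;x,y)=\frac{1}{1-s(x+\bar x)-t(y+\bar y)-st(a-1)(x\bar y+\bar x y)}.$$ (ii) The generating function $\mathcal W_{-,0}(a,s,t;x)$ of the walks ending on the $x$-axis equals $[y^0]\mathcal W(a,s,t;x,y)$; it is algebraic, and $$\mathcal W_{-,0}(a,s,t;x)=\frac{1}{\sqrt{(1-s(x+\bar x))^2-4t^2(1+sx(a-1))(1+s\bar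 x(a-1))}}.$$ (iii) The generating function $\mathcal W_{0,0}(a,s,t)$ of loops equals $[x^0y^0]\mathcal W(a,s,t;x,y)$; it is D-finite (with respect to each of the variables $a$, $s$, $t$ it satisfies a non-trivial linear differential equation with coefficients in $\mathbb Q[a,s,t]$), and $$\mathcal W_{0,0}(a,s,t)=\sum_{j\ge0}\binom{2j}{j}t^{2j}\,\mathcal W_{0,0,j}(a,s),\qquad \mathcal W_{0,0,j}(a,s)=[x^0]\frac{(1+sx(a-1))^j(1+s\bar x(a-1))^j}{(1-s(x+\bar x))^{2j+1}}.$$ (iv) The series $A(a,s,t)=\sum_{j\ge0}t^{2j}\,\mathcal W_{0,0,j}(a,s)$ is biquadratic: it is algebraic of degree $4$ over $\mathbb Q(a,s,t)$, and its minimal equation has degree $2$ in $A^2$. There is a unique series $T\in\mathbb Q[a][[s,t]]$ such that $T(a,0,t)=0$ and $$T=s^2\,\frac{1+4T-t^2(a-1)^2T}{1-t^2-t^2(a+1)^2T},$$ and, for this series $T$, $$A(a,s,t)=\frac{1+t^2(1-a^2)T}{\left(1-t^2(a^2-1)T\right)^2-t^2\left(1+2(a+1)T\right)^2}\,\sqrt{\frac{1+4T-t^2(a-1)^2T}{1-t^2(a-1)^2T}}.$$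 -/

import Mathlib

namespace SquareLattice

noncomputable section

/-! ### Walks -/

/-- The four unit steps East, North, West, South. -/
inductive Step
  | E | N | W | S
  deriving DecidableEq

instance : Fintype Step where
  elems := {Step.E, Step.N, Step.W, Step.S}
  complete := by intro p; cases p <;> simp

/-- Number of horizontal steps of a walk (a walk from the origin is the word of its steps). -/
def hSteps (w : List Step) : ℕ := w.count Step.E + w.count Step.W

/-- Number of vertical steps. -/
def vSteps (w : List Step) : ℕ := w.count Step.N + w.count Step.S

/-- Abscissa of the endpoint of the walk. -/
def endX (w : List Step) : ℤ := (w.count Step.E : ℤ) - (w.count Step.W : ℤ)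

/-- Ordinate of the endpoint of the walk. -/
def endY (w : List Step) : ℤ := (w.count Step.N : ℤ) - (w.count Step.S : ℤ)

/-- Number of `ES` and `NW` corners, i.e. of factors (pairs of consecutive steps) of the walk
equal to `ES` or to `NW`. -/
def corners : List Step → ℕ
  | [] => 0
  | [_] => 0
  | p :: q :: w =>
      (if (p = Step.E ∧ q = Step.S) ∨ (p = Step.N ∧ q = Step.W) then 1 else 0) + corners (q :: w)

/-! ### Rings of coefficients

All series are power series in `s = X 0` and `t = X 1`. -/

/-- `ℚ[a]`. -/
abbrev Qa : Type := Polynomial ℚ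

/-- `ℚ[a][x, x⁻¹]`. -/
abbrev Qax : Type := LaurentPolynomial Qa

/-- `ℚ[a][x, x⁻¹][y, y⁻¹]`. -/
abbrev Qaxy : Type := LaurentPolynomial Qax

/-- Power series in `s, t` with coefficients in `R`. -/
abbrev Ser (R : Type) : Type := MvPowerSeries (Fin 2) R

/-- Polynomials in `s, t` with coefficients in `R`. -/
abbrev Pol (R : Type) [CommRing R] : Type := MvPolynomial (Fin 2) R

/-- The variable `a`. -/
def a : Qa := Polynomial.X

/-- The monomial `x ^ k` of `ℚ[a][x, x⁻¹]`. -/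
def xpow (k : ℤ) : Qax := LaurentPolynomial.T k

/-- The monomial `x ^ k * y ^ l` of `ℚ[a][x, x⁻¹, y, y⁻¹]`. -/
def xypow (k l : ℤ) : Qaxy := LaurentPolynomial.C (xpow k) * LaurentPolynomial.T l

/-- The series `s`. -/
def s {R : Type} [CommRing R] : Ser R := MvPowerSeries.X 0

/-- The series `t`. -/
def t {R : Type} [CommRing R] : Ser R := MvPowerSeries.X 1

/-- Constants of `R` as series. -/
def c {R : Type} [CommRing R] (r : R) : Ser R := MvPowerSeries.C r

/-- Coefficient extraction `[z ^ 0]`, applied to all the coefficients of a series in `s, t`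
whose coefficients are Laurent polynomials in `z`. -/
def constTerm {R : Type} [CommRing R] (F : Ser (LaurentPolynomial R)) : Ser R :=
  fun n => (MvPowerSeries.coeff n F).coeff 0

/-! ### Generating functions of walks -/

open Classical in
/-- The generating function `∑ wt(w) s^(hSteps w) t^(vSteps w)` over all walks `w` satisfying `P`.
A walk with `n 0` horizontal and `n 1` vertical steps is a word of length `n 0 + n 1`. -/
def walkGF {R : Type} [CommRing R] (P : List Step → Prop) (wt : List Step → R) : Ser R :=
  fun n => ∑ w : Fin (n 0 + n 1) → Step,
    if hSteps (List.ofFn w) = n 0 ∧ vSteps (List.ofFn w) = n 1 ∧ P (List.ofFn w)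
    then wt (List.ofFn w) else 0

/-- `𝒲(a,s,t;x,y)`: all walks, by horizontal steps, vertical steps, corners and endpoint. -/
def gfAll : Ser Qaxy :=
  walkGF (fun _ => True)
    (fun w => LaurentPolynomial.C (LaurentPolynomial.C (a ^ corners w)) * xypow (endX w) (endY w))

/-- Walks ending on the `x`-axis, by horizontal steps, vertical steps, corners and abscissa of
the endpoint. -/
def gfAxis : Ser Qax :=
  walkGF (fun w => endY w = 0)
    (fun w => LaurentPolynomial.C (a ^ corners w) * xpow (endX w))

/-- Loops, by horizontal steps, vertical steps and corners. -/
def gfLoop : Ser Qa :=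
  walkGF (fun w => endX w = 0 ∧ endY w = 0) (fun w => a ^ corners w)

/-! ### Properties of series -/

/-- `R` is the square root of `F` with constant term `1`. -/
def IsSqrtSeries {K : Type} [CommRing K] (R F : Ser K) : Prop :=
  R ^ 2 = F ∧ MvPowerSeries.constantCoeff R = 1

/-- `F` is a quotient of two polynomials. -/
def IsRationalSeries {K : Type} [CommRing K] (F : Ser K) : Prop :=
  ∃ P Q : Pol K, Q ≠ 0 ∧ (Q : Ser K) * F = (P : Ser K)

/-- `F` is algebraic over the polynomials in `s, t`. -/
def IsAlgebraicSeries {K : Type} [CommRing K] (F : Ser K) : Prop :=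
  IsAlgebraic (Pol K) F

/-- `F` is algebraic of degree four over `ℚ(a,s,t)` and its minimal equation is quadratic
in `F ^ 2`. -/
def IsBiquadratic (F : Ser Qa) : Prop :=
  (∃ c₀ c₁ c₂ : Pol Qa, c₂ ≠ 0 ∧
    (c₂ : Ser Qa) * F ^ 4 + (c₁ : Ser Qa) * F ^ 2 + (c₀ : Ser Qa) = 0) ∧
  ∀ p : Polynomial (Pol Qa), p ≠ 0 → Polynomial.aeval F p = 0 → 4 ≤ p.natDegree

/-- The partial derivative with respect to `a`. -/
def derivA (F : Ser Qa) : Ser Qa :=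
  fun n => Polynomial.derivative (MvPowerSeries.coeff n F)

/-- The partial derivative with respect to `s`. -/
def derivS (F : Ser Qa) : Ser Qa := MvPowerSeries.pderiv Qa 0 F

/-- The partial derivative with respect to `t`. -/
def derivT (F : Ser Qa) : Ser Qa := MvPowerSeries.pderiv Qa 1 F

/-- `F` satisfies a non-trivial linear differential equation, for the derivation `δ`, with
coefficients in `ℚ[a,s,t]`. -/
def SatisfiesLDE (δ : Ser Qa → Ser Qa) (F : Ser Qa) : Prop :=
  ∃ (r : ℕ) (p : ℕ → Pol Qa), p r ≠ 0 ∧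
    ∑ k ∈ Finset.range (r + 1), (p k : Ser Qa) * δ^[k] F = 0

/-- D-finiteness of a series in the variables `a, s, t`: it satisfies a non-trivial linear
differential equation with polynomial coefficients in each of the variables. -/
def IsDFinite (F : Ser Qa) : Prop :=
  SatisfiesLDE derivA F ∧ SatisfiesLDE derivS F ∧ SatisfiesLDE derivT F

/-! ### The series of the statement -/

/-- `s (x + x⁻¹)`. -/
def sxx : Ser Qax := s * c (xpow 1 + xpow (-1))

/-- `1 - s (x + x⁻¹) - t (y + y⁻¹) - s t (a - 1) (x y⁻¹ + x⁻¹ y)`. -/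
def denomAll : Ser Qaxy :=
  1 - s * c (xypow 1 0 + xypow (-1) 0) - t * c (xypow 0 1 + xypow 0 (-1))
    - s * t * c (LaurentPolynomial.C (LaurentPolynomial.C (a - 1))
        * (xypow 1 (-1) + xypow (-1) 1))

/-- `(1 + s x (a - 1)) (1 + s x⁻¹ (a - 1))`. -/
def cornerFactor : Ser Qax :=
  (1 + s * c (xpow 1 * LaurentPolynomial.C (a - 1)))
    * (1 + s * c (xpow (-1) * LaurentPolynomial.C (a - 1)))

/-- `(1 - s (x + x⁻¹))² - 4 t² (1 + s x (a - 1)) (1 + s x⁻¹ (a - 1))`. -/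
def discAxis : Ser Qax := (1 - sxx) ^ 2 - 4 * t ^ 2 * cornerFactor

/-- `𝒲_{0,0,j}(a,s) =
[x⁰] (1 + s x (a - 1))^j (1 + s x⁻¹ (a - 1))^j / (1 - s (x + x⁻¹))^(2j+1)`,
where the inverse is that of a series with constant term `1`. -/
def W00 (j : ℕ) : Ser Qa :=
  constTerm (cornerFactor ^ j * (MvPowerSeries.invOfUnit (1 - sxx) 1) ^ (2 * j + 1))

/-- The formal sum `∑_{j ≥ 0} t^(2j) F_j`. The terms with `2 j > n 1` do not contribute to the
coefficient of `s^(n 0) t^(n 1)`. -/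
def sumTSq (F : ℕ → Ser Qa) : Ser Qa :=
  fun n => MvPowerSeries.coeff n (∑ j ∈ Finset.range (n 1 + 1), t ^ (2 * j) * F j)

/-- `A(a,s,t) = ∑_{j ≥ 0} t^(2j) 𝒲_{0,0,j}(a,s)`. -/
def serA : Ser Qa := sumTSq W00

/-- `T(a,0,t) = 0` and
`T = s² (1 + 4 T - t² (a-1)² T) / (1 - t² - t² (a+1)² T)`; under the first condition the
denominator has constant term `1`, hence is invertible. -/
def IsT (T : Ser Qa) : Prop :=
  (∀ n : Fin 2 →₀ ℕ, n 0 = 0 → MvPowerSeries.coeff n T = 0) ∧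
  T = s ^ 2 * (1 + 4 * T - t ^ 2 * c (a - 1) ^ 2 * T)
    * MvPowerSeries.invOfUnit (1 - t ^ 2 - t ^ 2 * c (a + 1) ^ 2 * T) 1

end

end SquareLattice

open SquareLattice

/-! All walks. A corner begins with E or N and ends with S or W. Writing a = 1 + (a - 1), a walk
whose first two steps form a corner gets an extra term with weight a - 1, and its second step can
then be stripped off freely, since no corner begins with S or W. Sorting by length gives a
recurrence of order two, whose sum telescopes against the denominator (`gfAll_mul_denomAll`).

Walks on the axis. In y the denominator is A - t(By + C/y). Expanding the geometric series and
taking [y^0] leaves the sum of binom(2j,j) t^(2j) (BC)^j / A^(2j+1) (`zCoeff_zero_expansion`). The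
central binomial series sums it to the inverse square root of A^2 - 4t^2 BC, and a termwise [x^0]
gives the formula for loops.

D-finiteness. Let F = D^(-1/2), with D a Laurent polynomial in x with exponents in [-2, 2]. The
derivatives of F of order at most 4 and the images under x d/dx of x^i F^7, |i| ≤ 6, are up to
powers of 2 equal to F^9 times Laurent polynomials with exponents in [-8, 8]: 18 elements in a
module spanned by 17. In the resulting relation [x^0] kills the images under x d/dx, leaving an
equation for [x^0] F (`PreservesLaurent.exists_equation`). It is nontrivial because no nonzero Q
F^7, with Q of exponents in [-6, 6], is free of x.

The series A. Without the binomials the sum over j is geometric, so A = [x^0] of a rational function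
whose denominator is symmetric in x and 1/x. It factors, up to the scalar ϖ, as (1 - σx + πx²)(1 -
σ/x + π/x²) with π = (R - 1)/(R + 1), R being the square root in the statement. Partial fractions
then give A (`serA_eq_of_factorization`, `partial_fraction_identities`).

Degree of A. A² lies in the quadratic extension generated by T. Modulo squares its norm is 4a + (t²
+ 4s²)(a - 1)². Neither this polynomial nor the discriminant of T is a square, since each takes a
negative value at a rational point. This forces degree 4 (`biquadratic_of_norm`). -/

namespace SquareLattice

noncomputable section

open MvPowerSeries

/-! ### Coefficient extraction -/

section Coefficients

variable {R : Type} [CommRing R]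

/-- Coefficient extraction `[z ^ k]` in a series with coefficients in `R[z, z⁻¹]`. -/
def zCoeff (k : ℤ) : Ser (LaurentPolynomial R) →ₗ[Ser R] Ser R where
  toFun F := (fun n => (coeff n F).coeff k : (Fin 2 →₀ ℕ) → R)
  map_add' F G := by
    ext n
    change (coeff n (F + G)).coeff k = (coeff n F).coeff k + (coeff n G).coeff k
    simp
  map_smul' F G := by
    classical
    refine MvPowerSeries.ext fun n => ?_
    refine Eq.trans ?_ (coeff_mul (σ := Fin 2) n F _).symm
    change (coeff n (F • G)).coeff k = _
    rw [Algebra.smul_def, algebraMap_apply'', coeff_mul,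
      AddMonoidAlgebra.coeff_sum, Finset.sum_apply']
    refine Finset.sum_congr rfl fun p _ => ?_
    rw [coeff_map, ← LaurentPolynomial.C_eq_algebraMap, ← LaurentPolynomial.smul_eq_C_mul]
    rfl

theorem coeff_zCoeff (k : ℤ) (F : Ser (LaurentPolynomial R)) (n : Fin 2 →₀ ℕ) :
    coeff n (zCoeff k F) = (coeff n F).coeff k := rfl

theorem constTerm_eq_zCoeff (F : Ser (LaurentPolynomial R)) : constTerm F = zCoeff 0 F := rfl

theorem zCoeff_c_T_mul (k l : ℤ) (F : Ser (LaurentPolynomial R)) :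
    zCoeff k (c (LaurentPolynomial.T l) * F) = zCoeff (k - l) F := by
  ext n
  rw [coeff_zCoeff, coeff_zCoeff, c, coeff_C_mul]
  have := AddMonoidAlgebra.coeff_single_mul_add (coeff n F) (1 : R) l (k - l)
  rwa [add_sub_cancel, one_mul] at this

/-- A series in `s, t`, seen as a series whose coefficients are constants of `R[z, z⁻¹]`. -/
def constSer : Ser R →+* Ser (LaurentPolynomial R) :=
  algebraMap (Ser R) (Ser (LaurentPolynomial R))

theorem constSer_s : constSer (R := R) s = s := by
  rw [constSer, algebraMap_apply'', s, map_X]; rfl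

theorem constSer_t : constSer (R := R) t = t := by
  rw [constSer, algebraMap_apply'', t, map_X]; rfl

theorem constSer_c (r : R) :
    constSer (R := R) (c r) = c (LaurentPolynomial.C r) := by
  rw [constSer, algebraMap_apply'', c, map_C]; rfl

theorem zCoeff_constSer_mul (k : ℤ) (F : Ser R) (G : Ser (LaurentPolynomial R)) :
    zCoeff k (constSer F * G) = F * zCoeff k G := by
  rw [constSer, ← Algebra.smul_def, map_smul, smul_eq_mul]

theorem zCoeff_c_T (k l : ℤ) :
    zCoeff k (c (LaurentPolynomial.T l) : Ser (LaurentPolynomial R)) = if k = l then 1 else 0 := by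
  classical
  ext n
  rw [coeff_zCoeff, c, coeff_C]
  by_cases hn : n = 0 <;> by_cases hk : k = l <;>
    simp [hn, hk, coeff_one, LaurentPolynomial.T_apply, eq_comm]

theorem zCoeff_one (k : ℤ) :
    zCoeff k (1 : Ser (LaurentPolynomial R)) = if k = 0 then 1 else 0 := by
  have := zCoeff_c_T (R := R) k 0
  rwa [LaurentPolynomial.T_zero, c, map_one] at this

theorem coeff_t_pow_mul_of_lt {N : ℕ} {n : Fin 2 →₀ ℕ} (h : n 1 < N) (F : Ser R) :
    coeff n (t ^ N * F) = 0 := by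
  classical
  rw [t, X_pow_eq, coeff_monomial_mul, if_neg]
  intro hle
  have := hle 1
  simp at this
  omega

/-- A series that is congruent to another one modulo all the powers of `t` is equal to it. -/
theorem eq_of_forall_t_pow_dvd {F G : Ser R} (h : ∀ N : ℕ, ∃ K, F = G + t ^ N * K) : F = G := by
  ext n
  obtain ⟨K, hK⟩ := h (n 1 + 1)
  rw [hK, map_add, coeff_t_pow_mul_of_lt (Nat.lt_succ_self _), add_zero]

/-- Taking N = n 1 + 1 at the coefficient n reproduces the cutoff built into `sumTSq`, and the
remainder is invisible there. -/
theorem eq_sumTSq {G : ℕ → Ser Qa} {F : Ser Qa}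
    (h : ∀ N : ℕ, ∃ K, F = ∑ j ∈ Finset.range N, t ^ (2 * j) * G j + t ^ N * K) :
    F = sumTSq G := by
  ext n
  obtain ⟨K, hK⟩ := h (n 1 + 1)
  rw [hK, map_add, coeff_t_pow_mul_of_lt (Nat.lt_succ_self _), add_zero]
  rfl

end Coefficients

/-! ### All walks -/

section Walks

variable {R : Type} [CommRing R]

theorem sum_ofFn_succ {M : Type*} [AddCommMonoid M] (n : ℕ) (f : List Step → M) :
    ∑ w : Fin (n + 1) → Step, f (List.ofFn w)
      = ∑ p : Step, ∑ w : Fin n → Step, f (p :: List.ofFn w) := by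
  rw [← Fintype.sum_prod_type' (f := fun p (w : Fin n → Step) => f (p :: List.ofFn w))]
  refine (Fintype.sum_equiv (Fin.consEquiv fun _ => Step) _ _ fun x => ?_).symm
  exact congrArg f (List.ofFn_cons x.1 x.2).symm

theorem sum_step {M : Type*} [AddCommMonoid M] (f : Step → M) :
    ∑ p : Step, f p = f Step.E + f Step.N + f Step.W + f Step.S := by
  change ∑ p ∈ ({Step.E, Step.N, Step.W, Step.S} : Finset Step), f p = _
  simp [add_assoc]

theorem hSteps_add_vSteps (w : List Step) : hSteps w + vSteps w = w.length := by
  induction w with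
  | nil => rfl
  | cons p w ih =>
    simp only [hSteps, vSteps, List.count_cons, List.length_cons] at ih ⊢
    cases p <;> simp <;> omega

/-- The monomial of a walk in the generating function with weight `wt`. -/
def walkTerm (wt : List Step → R) (w : List Step) : Ser R :=
  s ^ hSteps w * t ^ vSteps w * c (wt w)

theorem coeff_walkTerm (wt : List Step → R) (w : List Step) (n : Fin 2 →₀ ℕ) :
    coeff n (walkTerm wt w) = if hSteps w = n 0 ∧ vSteps w = n 1 then wt w else 0 := by
  classical
  rw [walkTerm, c, coeff_mul_C, s, t, X_pow_eq, X_pow_eq, monomial_mul_monomial, coeff_monomial]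
  have : n = Finsupp.single 0 (hSteps w) + Finsupp.single 1 (vSteps w)
      ↔ hSteps w = n 0 ∧ vSteps w = n 1 := by
    constructor
    · intro h; rw [h]; simp
    · rintro ⟨h0, h1⟩
      ext i
      fin_cases i <;> simp [h0, h1]
  simp [this]

/-- Words of length k are homogeneous of degree k in s, t, so any truncation beyond the degree of n
sees the full coefficient. -/
theorem coeff_walkGF_true (wt : List Step → R) (n : Fin 2 →₀ ℕ) {N : ℕ} (hN : n 0 + n 1 < N) :
    coeff n (walkGF (fun _ => True) wt)
      = coeff n (∑ k ∈ Finset.range N, ∑ w : Fin k → Step, walkTerm wt (List.ofFn w)) := by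
  rw [map_sum, Finset.sum_eq_single (n 0 + n 1)]
  · rw [map_sum]
    change ∑ w : Fin (n 0 + n 1) → Step, _ = _
    refine Finset.sum_congr rfl fun w _ => ?_
    rw [coeff_walkTerm]
    simp
  · intro k _ hk
    rw [map_sum]
    refine Finset.sum_eq_zero fun w _ => ?_
    rw [coeff_walkTerm, if_neg]
    rintro ⟨h0, h1⟩
    have := hSteps_add_vSteps (List.ofFn w)
    rw [List.length_ofFn] at this
    omega
  · intro h
    simp at h
    omega

theorem coeff_sum_walkTerm_of_lt (wt : List Step → R) {k : ℕ} {n : Fin 2 →₀ ℕ}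
    (h : n 0 + n 1 < k) : coeff n (∑ w : Fin k → Step, walkTerm wt (List.ofFn w)) = 0 := by
  rw [map_sum]
  refine Finset.sum_eq_zero fun w _ => ?_
  rw [coeff_walkTerm, if_neg]
  rintro ⟨h0, h1⟩
  have := hSteps_add_vSteps (List.ofFn w)
  rw [List.length_ofFn] at this
  omega

/-- The weight of a walk in `gfAll`. -/
def wtAll (w : List Step) : Qaxy :=
  LaurentPolynomial.C (LaurentPolynomial.C (a ^ corners w)) * xypow (endX w) (endY w)

/-- The monomial of a single step. -/
def stepTerm (p : Step) : Ser Qaxy := walkTerm wtAll [p]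

theorem xypow_add (k l k' l' : ℤ) : xypow (k + k') (l + l') = xypow k l * xypow k' l' := by
  simp only [xypow, xpow, LaurentPolynomial.T_add, map_mul]
  ring

theorem walkTerm_cons_of_corners (p : Step) (w : List Step) (e : ℕ)
    (h : corners (p :: w) = e + corners w) :
    walkTerm wtAll (p :: w)
      = c (LaurentPolynomial.C (LaurentPolynomial.C (a ^ e))) * (stepTerm p * walkTerm wtAll w) := by
  have h1 : hSteps (p :: w) = hSteps [p] + hSteps w := by
    simp only [hSteps, List.count_cons, List.count_nil]; omega
  have h2 : vSteps (p :: w) = vSteps [p] + vSteps w := by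
    simp only [vSteps, List.count_cons, List.count_nil]; omega
  have h3 : endX (p :: w) = endX [p] + endX w := by
    simp only [endX, List.count_cons, List.count_nil]; push_cast; ring
  have h4 : endY (p :: w) = endY [p] + endY w := by
    simp only [endY, List.count_cons, List.count_nil]; push_cast; ring
  simp only [stepTerm, walkTerm, wtAll, h1, h2, h3, h4, h, xypow_add, pow_add, map_mul, c,
    show corners [p] = 0 from rfl, pow_zero, map_one]
  ring

/-- No corner begins with S, so no correction appears. With the same fact for W, this closes the
recurrence on lengths, because every corner ends with S or W. -/
theorem walkTerm_cons_S (w : List Step) :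
    walkTerm wtAll (Step.S :: w) = stepTerm Step.S * walkTerm wtAll w := by
  have h : corners (Step.S :: w) = 0 + corners w := by cases w <;> simp [corners]
  simpa [c] using walkTerm_cons_of_corners _ _ _ h

theorem walkTerm_cons_W (w : List Step) :
    walkTerm wtAll (Step.W :: w) = stepTerm Step.W * walkTerm wtAll w := by
  have h : corners (Step.W :: w) = 0 + corners w := by cases w <;> simp [corners]
  simpa [c] using walkTerm_cons_of_corners _ _ _ h

/-- `a - 1` as a series. -/
def am1 : Ser Qaxy := c (LaurentPolynomial.C (LaurentPolynomial.C (a - 1)))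

theorem walkTerm_cons_cons (p q : Step) (w : List Step) :
    walkTerm wtAll (p :: q :: w) = stepTerm p * walkTerm wtAll (q :: w)
      + if (p = Step.E ∧ q = Step.S) ∨ (p = Step.N ∧ q = Step.W)
        then am1 * (stepTerm p * walkTerm wtAll (q :: w)) else 0 := by
  split_ifs with h
  · rw [walkTerm_cons_of_corners p (q :: w) 1 (by simp [corners, h])]
    simp only [am1, c, pow_one, map_sub, map_one]
    ring
  · rw [walkTerm_cons_of_corners p (q :: w) 0 (by simp [corners, h])]
    simp [c]

/-- The generating function of walks of length `k`. -/
def gfLength (k : ℕ) : Ser Qaxy := ∑ w : Fin k → Step, walkTerm wtAll (List.ofFn w)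

theorem gfLength_zero : gfLength 0 = 1 := by
  simp [gfLength, walkTerm, wtAll, hSteps, vSteps, corners, endX, endY, xypow, xpow, c]

theorem gfLength_one : gfLength 1 = ∑ p, stepTerm p := by
  rw [gfLength, sum_ofFn_succ]
  simp [stepTerm]

/-- The first term treats the first step as independent of the rest. The second corrects the weight
when the first two steps form a corner; the step S or W then factors out, leaving an arbitrary walk
of length k. -/
theorem gfLength_add_two (k : ℕ) :
    gfLength (k + 2) = (∑ p, stepTerm p) * gfLength (k + 1)
      + am1 * (stepTerm Step.E * stepTerm Step.S + stepTerm Step.N * stepTerm Step.W)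
        * gfLength k := by
  have h1 : gfLength (k + 1)
      = ∑ q : Step, ∑ w : Fin k → Step, walkTerm wtAll (q :: List.ofFn w) := by
    rw [gfLength, sum_ofFn_succ]
  have hS : ∑ w : Fin k → Step, walkTerm wtAll (Step.S :: List.ofFn w)
      = stepTerm Step.S * gfLength k := by
    simp only [walkTerm_cons_S, gfLength, Finset.mul_sum]
  have hW : ∑ w : Fin k → Step, walkTerm wtAll (Step.W :: List.ofFn w)
      = stepTerm Step.W * gfLength k := by
    simp only [walkTerm_cons_W, gfLength, Finset.mul_sum]
  rw [gfLength, sum_ofFn_succ]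
  have h2 (p : Step) := sum_ofFn_succ k (fun l => walkTerm wtAll (p :: l))
  simp only [h2, walkTerm_cons_cons, Finset.sum_add_distrib, ← Finset.mul_sum, ← h1]
  rw [← Finset.sum_mul]
  congr 1
  simp only [sum_step]
  simp only [reduceCtorEq, and_false, or_false, if_false, and_true,
    and_self, if_true, Finset.sum_const_zero, or_true, ← Finset.mul_sum, hS, hW]
  ring

theorem denomAll_eq :
    denomAll = 1 - (∑ p, stepTerm p)
      - am1 * (stepTerm Step.E * stepTerm Step.S + stepTerm Step.N * stepTerm Step.W) := by
  have hE : stepTerm Step.E = s * c (xypow 1 0) := by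
    simp [stepTerm, walkTerm, wtAll, hSteps, vSteps, corners, endX, endY]
  have hN : stepTerm Step.N = t * c (xypow 0 1) := by
    simp [stepTerm, walkTerm, wtAll, hSteps, vSteps, corners, endX, endY]
  have hW : stepTerm Step.W = s * c (xypow (-1) 0) := by
    simp [stepTerm, walkTerm, wtAll, hSteps, vSteps, corners, endX, endY]
  have hS : stepTerm Step.S = t * c (xypow 0 (-1)) := by
    simp [stepTerm, walkTerm, wtAll, hSteps, vSteps, corners, endX, endY]
  have h1 : xypow 1 (-1) = xypow 1 0 * xypow 0 (-1) := by rw [← xypow_add]; simp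
  have h2 : xypow (-1) 1 = xypow 0 1 * xypow (-1) 0 := by rw [← xypow_add]; simp
  rw [sum_step, hE, hN, hW, hS, denomAll, am1, h1, h2]
  simp only [c, map_add, map_mul]
  ring

/-- Multiplying by the characteristic polynomial of the recurrence telescopes the partial sums; the
boundary terms have degree at least N + 1 in s, t, as e has degree 2. -/
theorem sum_gfLength_mul_denomAll (N : ℕ) :
    (∑ k ∈ Finset.range (N + 1), gfLength k) * denomAll
      = 1 - gfLength (N + 1)
        - am1 * (stepTerm Step.E * stepTerm Step.S + stepTerm Step.N * stepTerm Step.W)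
          * gfLength N := by
  rw [denomAll_eq]
  induction N with
  | zero => simp [gfLength_zero, gfLength_one]
  | succ N ih =>
    rw [Finset.sum_range_succ, add_mul, ih, gfLength_add_two N]
    ring

theorem coeff_gfLength {k : ℕ} {n : Fin 2 →₀ ℕ} (h : n 0 + n 1 < k) :
    coeff n (gfLength k) = 0 :=
  coeff_sum_walkTerm_of_lt wtAll h

theorem coeff_mul_congr_of_degree {F F' : Ser R} (G : Ser R) {n : Fin 2 →₀ ℕ}
    (h : ∀ m : Fin 2 →₀ ℕ, m 0 + m 1 ≤ n 0 + n 1 → coeff m F = coeff m F') :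
    coeff n (F * G) = coeff n (F' * G) := by
  classical
  rw [coeff_mul, coeff_mul]
  refine Finset.sum_congr rfl fun p hp => ?_
  replace hp : p.1 + p.2 = n := Finset.HasAntidiagonal.mem_antidiagonal.mp hp
  rw [h]
  rw [← hp]
  simp only [Finsupp.add_apply]
  omega

theorem mul_eq_one_of_forall_coeff_eq {F D : Ser R} {A B : ℕ → Ser R} {e : Ser R}
    (hF : ∀ (N : ℕ) (m : Fin 2 →₀ ℕ), m 0 + m 1 < N → coeff m F = coeff m (A N))
    (hB : ∀ (N : ℕ) (m : Fin 2 →₀ ℕ), m 0 + m 1 < N → coeff m (B N) = 0)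
    (hA : ∀ N : ℕ, A (N + 1) * D = 1 - B (N + 1) - e * B N) : F * D = 1 := by
  ext1 n
  -- With N = n 0 + n 1 + 1, both boundary terms `B (N + 1)` and `B N` vanish in every degree up to
  -- that of n.
  rw [coeff_mul_congr_of_degree D fun m hm => hF (n 0 + n 1 + 1 + 1) m (by omega), hA, map_sub,
    map_sub, hB _ _ (by omega), mul_comm e, coeff_mul_congr_of_degree (F' := 0) e, zero_mul,
    map_zero, sub_zero, sub_zero]
  intro m hm
  rw [hB _ _ (by omega), map_zero]

theorem gfAll_mul_denomAll : gfAll * denomAll = 1 :=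
  mul_eq_one_of_forall_coeff_eq (F := gfAll) (D := denomAll) (B := gfLength)
    (A := fun N => ∑ k ∈ Finset.range N, gfLength k)
    (e := am1 * (stepTerm Step.E * stepTerm Step.S + stepTerm Step.N * stepTerm Step.W))
    (fun _ m hm => coeff_walkGF_true wtAll m hm)
    (fun _ _ hm => coeff_gfLength hm) sum_gfLength_mul_denomAll

theorem isRationalSeries_of_mul_eq_one [Nontrivial R] {F : Ser R} (P : Pol R)
    (h : F * (P : Ser R) = 1) : IsRationalSeries F := by
  refine ⟨1, P, ?_, ?_⟩
  · rintro rfl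
    simp at h
  · rw [mul_comm, h, MvPolynomial.coe_one]

theorem coe_linear_combination (r₁ r₂ r₃ : R) :
    ((1 - MvPolynomial.X 0 * MvPolynomial.C r₁ - MvPolynomial.X 1 * MvPolynomial.C r₂
      - MvPolynomial.X 0 * MvPolynomial.X 1 * MvPolynomial.C r₃ : Pol R) : Ser R)
      = 1 - s * c r₁ - t * c r₂ - s * t * c r₃ := by
  have h (P Q : Pol R) : ((P - Q : Pol R) : Ser R) = P - Q :=
    map_sub (MvPolynomial.coeToMvPowerSeries.ringHom (σ := Fin 2) (R := R)) P Q
  simp only [h, MvPolynomial.coe_one, MvPolynomial.coe_mul, MvPolynomial.coe_X, MvPolynomial.coe_C]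
  rfl

theorem isRationalSeries_gfAll : IsRationalSeries gfAll := by
  refine isRationalSeries_of_mul_eq_one (F := gfAll) _
    ((congrArg (gfAll * ·) (coe_linear_combination (xypow 1 0 + xypow (-1) 0)
      (xypow 0 1 + xypow 0 (-1)) (LaurentPolynomial.C (LaurentPolynomial.C (a - 1))
        * (xypow 1 (-1) + xypow (-1) 1)))).trans gfAll_mul_denomAll)

/-! ### Walks on the axis and loops as constant terms -/

theorem gfAxis_eq_constTerm : gfAxis = constTerm gfAll := by
  classical
  ext1 n
  change ∑ w : Fin (n 0 + n 1) → Step, _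
    = AddMonoidAlgebra.coeff (∑ w : Fin (n 0 + n 1) → Step, _) 0
  rw [AddMonoidAlgebra.coeff_sum, Finset.sum_apply']
  refine Finset.sum_congr rfl fun w _ => ?_
  by_cases h : hSteps (List.ofFn w) = n 0 ∧ vSteps (List.ofFn w) = n 1
  · simp only [xypow]
    rw [← mul_assoc, ← map_mul, ← LaurentPolynomial.smul_eq_C_mul]
    by_cases hy : endY (List.ofFn w) = 0
    · simp [h, hy]
    · simp [h, hy, ← LaurentPolynomial.smul_eq_C_mul, LaurentPolynomial.T_apply]
  · simp [h, ← and_assoc]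

theorem gfLoop_eq_constTerm : gfLoop = constTerm gfAxis := by
  classical
  ext1 n
  change ∑ w : Fin (n 0 + n 1) → Step, _
    = AddMonoidAlgebra.coeff (∑ w : Fin (n 0 + n 1) → Step, _) 0
  rw [AddMonoidAlgebra.coeff_sum, Finset.sum_apply']
  refine Finset.sum_congr rfl fun w _ => ?_
  by_cases h : hSteps (List.ofFn w) = n 0 ∧ vSteps (List.ofFn w) = n 1
  · simp only [xpow]
    rw [← LaurentPolynomial.smul_eq_C_mul]
    by_cases hy : endY (List.ofFn w) = 0 <;> by_cases hx : endX (List.ofFn w) = 0 <;>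
      simp [h, hy, hx]
  · simp [h, ← and_assoc]

end Walks

/-! ### The central binomial series and square roots -/

/-- The series `∑ binom(2j, j) X^j`. -/
def centralBinomSeries : PowerSeries ℚ := PowerSeries.mk fun n => (n.centralBinom : ℚ)

/-- This is the recurrence (n + 1) binom(2n+2, n+1) = 2(2n + 1) binom(2n, n) in differential form.
-/
theorem derivative_centralBinomSeries :
    (1 - 4 * PowerSeries.X) * PowerSeries.derivative ℚ centralBinomSeries
      = 2 * centralBinomSeries := by
  ext n
  have h4 : (4 : PowerSeries ℚ) = PowerSeries.C (4 : ℚ) := (map_ofNat _ _).symm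
  have h2 : (2 : PowerSeries ℚ) = PowerSeries.C (2 : ℚ) := (map_ofNat _ _).symm
  have key (n : ℕ) : ((n + 1 : ℕ) : ℚ) * (n + 1).centralBinom = 2 * (2 * n + 1) * n.centralBinom := by
    exact_mod_cast Nat.succ_mul_centralBinom_succ n
  rw [sub_mul, one_mul, map_sub, mul_assoc, h4, h2, PowerSeries.coeff_C_mul,
    PowerSeries.coeff_C_mul]
  cases n with
  | zero =>
    simp [PowerSeries.coeff_derivative, centralBinomSeries, Nat.centralBinom]
  | succ n =>
    rw [PowerSeries.coeff_succ_X_mul]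
    have := key (n + 1)
    simp only [PowerSeries.coeff_derivative, centralBinomSeries, PowerSeries.coeff_mk] at this ⊢
    push_cast at this ⊢
    linarith

/-- By the differential equation, the left side has derivative zero; its constant term is 1. -/
theorem centralBinomSeries_sq_mul : centralBinomSeries ^ 2 * (1 - 4 * PowerSeries.X) = 1 := by
  apply PowerSeries.derivative.ext
  · have h4 : PowerSeries.derivative ℚ (4 : PowerSeries ℚ) = 0 := by
      have : (4 : PowerSeries ℚ) = PowerSeries.C (4 : ℚ) := (map_ofNat _ _).symm
      rw [this, PowerSeries.derivative_C]
    have h := derivative_centralBinomSeries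
    simp only [Derivation.leibniz, map_sub, Derivation.map_one_eq_zero, smul_eq_mul,
      PowerSeries.derivative_X, sq, h4]
    linear_combination 2 * centralBinomSeries * h
  · simp [centralBinomSeries]

section SquareRoots

variable {R : Type} [CommRing R]

/-- Substitution of V in the central binomial series. The last clause records the expansion through
truncations with remainder divisible by V^N, so that it can be compared with other series modulo
powers of t. -/
theorem exists_centralBinom_expansion [Algebra ℚ R] {V : Ser R} (hV : constantCoeff V = 0) :
    ∃ G : Ser R, G ^ 2 * (1 - 4 * V) = 1 ∧ constantCoeff G = 1 ∧
      ∀ N : ℕ, ∃ K, G = ∑ j ∈ Finset.range N, ((2 * j).choose j : Ser R) * V ^ j + V ^ N * K := by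
  have hs := PowerSeries.HasSubst.of_constantCoeff_zero hV
  set φ : PowerSeries ℚ →ₐ[ℚ] Ser R := PowerSeries.substAlgHom hs with hφ
  have hX : φ PowerSeries.X = V := PowerSeries.substAlgHom_X hs
  have hexp : ∀ N : ℕ, ∃ K, φ centralBinomSeries
      = ∑ j ∈ Finset.range N, ((2 * j).choose j : Ser R) * V ^ j + V ^ N * K := by
    intro N
    have hd : (PowerSeries.X : PowerSeries ℚ) ^ N ∣ centralBinomSeries
        - ∑ j ∈ Finset.range N, ((2 * j).choose j : PowerSeries ℚ) * PowerSeries.X ^ j := by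
      rw [PowerSeries.X_pow_dvd_iff]
      intro m hm
      have hc (j : ℕ) : (((2 * j).choose j : ℕ) : PowerSeries ℚ)
          = PowerSeries.C ((2 * j).choose j : ℚ) := by simp
      rw [map_sub, map_sum]
      simp only [hc, PowerSeries.coeff_C_mul, PowerSeries.coeff_X_pow]
      simp [centralBinomSeries, Nat.centralBinom, hm]
    obtain ⟨K, hK⟩ := hd
    refine ⟨φ K, ?_⟩
    rw [← sub_eq_iff_eq_add', ← hX, ← map_pow, ← map_mul, ← hK, map_sub, map_sum]
    simp only [map_mul, map_pow, map_natCast]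
  refine ⟨φ centralBinomSeries, ?_, ?_, hexp⟩
  · have := congrArg φ centralBinomSeries_sq_mul
    rwa [map_mul, map_pow, map_sub, map_one, map_mul, hX, map_ofNat] at this
  · obtain ⟨K, hK⟩ := hexp 1
    rw [hK]
    simp [hV]

theorem exists_isSqrtSeries [Algebra ℚ R] {F : Ser R} (hF : constantCoeff F = 1) :
    ∃ S, IsSqrtSeries S F := by
  -- F = 1 - 4V, so the lemma yields an inverse square root G of F, and G * F is the square root.
  set V : Ser R := (4⁻¹ : ℚ) • (1 - F) with hV
  have h4 : 4 * V = 1 - F := by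
    have : (4 : Ser R) = algebraMap ℚ (Ser R) 4 := by rw [map_ofNat]
    rw [hV, this, ← Algebra.smul_def, smul_smul]
    norm_num
  have hV0 : constantCoeff V = 0 := by
    have h := congrArg (constantCoeff (σ := Fin 2) (R := R)) h4
    rw [map_mul, map_sub, map_one, hF, sub_self, map_ofNat] at h
    have : (4⁻¹ : ℚ) • ((4 : R) * constantCoeff V) = 0 := by rw [h, smul_zero]
    have h4' : (4 : R) = algebraMap ℚ R 4 := by rw [map_ofNat]
    rw [h4', ← Algebra.smul_def, smul_smul] at this
    norm_num at this
    exact this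
  obtain ⟨G, hG, hG1, -⟩ := exists_centralBinom_expansion hV0
  rw [h4, sub_sub_cancel] at hG
  refine ⟨G * F, ?_, by rw [map_mul, hG1, hF, one_mul]⟩
  linear_combination F * hG

/-! ### Expansion in powers of `t` -/

theorem zCoeff_zero_binomial_pow (B C : Ser R) (n : ℕ) :
    zCoeff 0 ((constSer B * c (LaurentPolynomial.T 1)
      + constSer C * c (LaurentPolynomial.T (-1))) ^ n)
      = ∑ m ∈ Finset.range (n + 1),
        if n = 2 * m then B ^ m * C ^ (n - m) * (n.choose m : Ser R) else 0 := by
  rw [add_pow, map_sum]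
  refine Finset.sum_congr rfl fun m hm => ?_
  have hT (k : ℕ) (l : ℤ) : (c (LaurentPolynomial.T l) : Ser (LaurentPolynomial R)) ^ k
      = c (LaurentPolynomial.T (k * l)) := by
    rw [c, c, ← map_pow, LaurentPolynomial.T_pow]
  have hTT (k l : ℤ) : (c (LaurentPolynomial.T k) : Ser (LaurentPolynomial R))
      * c (LaurentPolynomial.T l) = c (LaurentPolynomial.T (k + l)) := by
    rw [c, c, c, ← map_mul, LaurentPolynomial.T_add]
  have : (constSer B * c (LaurentPolynomial.T 1)) ^ m
      * (constSer C * c (LaurentPolynomial.T (-1))) ^ (n - m)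
      * (n.choose m : Ser (LaurentPolynomial R))
      = constSer (B ^ m * C ^ (n - m) * (n.choose m : Ser R))
        * c (LaurentPolynomial.T (m * 1 + (n - m : ℕ) * (-1))) := by
    rw [mul_pow, mul_pow, hT, hT, ← hTT, map_mul, map_mul, map_pow, map_pow, map_natCast]
    ring
  rw [this, zCoeff_constSer_mul, zCoeff_c_T]
  have hm' : m ≤ n := Nat.lt_succ_iff.mp (Finset.mem_range.mp hm)
  by_cases h : n = 2 * m
  · rw [if_pos h, if_pos (by push_cast [hm']; omega), mul_one]
  · rw [if_neg h, if_neg (by push_cast [hm']; omega), mul_zero]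

theorem zCoeff_zero_binomial_pow_even (B C : Ser R) (n : ℕ) :
    zCoeff 0 ((constSer B * c (LaurentPolynomial.T 1) + constSer C * c (LaurentPolynomial.T (-1)))
      ^ (2 * n)) = B ^ n * C ^ n * ((2 * n).choose n : Ser R) := by
  rw [zCoeff_zero_binomial_pow, Finset.sum_eq_single n, if_pos rfl, show 2 * n - n = n by omega]
  · intro m _ hm
    rw [if_neg (by omega)]
  · intro h
    simp at h
    omega

theorem zCoeff_zero_binomial_pow_odd (B C : Ser R) (n : ℕ) :
    zCoeff 0 ((constSer B * c (LaurentPolynomial.T 1) + constSer C * c (LaurentPolynomial.T (-1)))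
      ^ (2 * n + 1)) = 0 := by
  rw [zCoeff_zero_binomial_pow]
  refine Finset.sum_eq_zero fun m _ => ?_
  rw [if_neg (by omega)]

/-- Geometric expansion of W in powers of t Z, with Z = Bz + C/z: odd powers of Z have no constant
term, and Z^(2j) contributes binom(2j, j)(BC)^j. -/
theorem zCoeff_zero_expansion {A B C U : Ser R} (hU : A * U = 1) {W : Ser (LaurentPolynomial R)}
    (hW : W * (constSer A
      - t * (constSer B * c (LaurentPolynomial.T 1)
        + constSer C * c (LaurentPolynomial.T (-1)))) = 1)
    (N : ℕ) : ∃ K, zCoeff 0 W = ∑ j ∈ Finset.range N,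
      ((2 * j).choose j : Ser R) * t ^ (2 * j) * ((B * C) ^ j * U ^ (2 * j + 1))
        + t ^ (2 * N) * K := by
  set ι := constSer (R := R) with hι
  set Z := ι B * c (LaurentPolynomial.T 1) + ι C * c (LaurentPolynomial.T (-1)) with hZ
  have hιU : ι A * ι U = 1 := by rw [← map_mul, hU, map_one]
  have hrec : W = ι U + t * Z * ι U * W := by linear_combination ι U * hW - W * hιU
  -- The induction needs the exact remainder of the geometric series, not just its existence.
  suffices h : zCoeff 0 W = ∑ j ∈ Finset.range N,
      ((2 * j).choose j : Ser R) * t ^ (2 * j) * ((B * C) ^ j * U ^ (2 * j + 1))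
        + t ^ (2 * N) * zCoeff 0 (Z ^ (2 * N) * (ι U ^ (2 * N) * W)) from ⟨_, h⟩
  induction N with
  | zero => simp
  | succ N ih =>
    -- The recursion for W is applied twice, producing one even power, one odd power and the next
    -- remainder.
    have hW2 : Z ^ (2 * N) * (ι U ^ (2 * N) * W)
        = ι (U ^ (2 * N + 1)) * Z ^ (2 * N) + ι (t * U ^ (2 * N + 2)) * Z ^ (2 * N + 1)
          + ι (t ^ 2) * (Z ^ (2 * (N + 1)) * (ι U ^ (2 * (N + 1)) * W)) := by
      simp only [map_mul, map_pow, hι, constSer_t]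
      simp only [← hι]
      linear_combination (Z ^ (2 * N) * ι U ^ (2 * N) * (1 + t * Z * ι U)) * hrec
    rw [ih, Finset.sum_range_succ, hW2, map_add, map_add, zCoeff_constSer_mul,
      zCoeff_constSer_mul, zCoeff_constSer_mul, hZ, hι, zCoeff_zero_binomial_pow_even,
      zCoeff_zero_binomial_pow_odd]
    ring

/-! ### Closed forms for walks on the axis and expansions of loops and A -/

/-- The series `1 / (1 - s (x + x⁻¹))`. -/
def invAxis : Ser Qax := invOfUnit (1 - sxx) 1

theorem constantCoeff_s : constantCoeff (s : Ser R) = 0 := by rw [s, constantCoeff_X]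

theorem constantCoeff_t : constantCoeff (t : Ser R) = 0 := by rw [t, constantCoeff_X]

theorem constantCoeff_c (r : R) : constantCoeff (c r) = r := by rw [c, constantCoeff_C]

theorem constantCoeff_sxx : constantCoeff sxx = 0 := by
  rw [sxx, map_mul, constantCoeff_s, zero_mul]

theorem one_sub_sxx_mul_invAxis : (1 - sxx) * invAxis = 1 := by
  apply mul_invOfUnit
  rw [map_sub, constantCoeff_sxx, map_one, sub_zero, Units.val_one]

theorem constantCoeff_invAxis : constantCoeff invAxis = 1 := by
  rw [invAxis, constantCoeff_invOfUnit, inv_one, Units.val_one]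

/-- `1 + s x ^ k (a - 1)`. -/
def cornerLin (k : ℤ) : Ser Qax := 1 + s * c (xpow k * LaurentPolynomial.C (a - 1))

theorem cornerFactor_eq : cornerFactor = cornerLin (-1) * cornerLin 1 := mul_comm _ _

theorem denomAll_eq_constSer :
    denomAll = constSer (1 - sxx)
      - t * (constSer (cornerLin (-1)) * c (LaurentPolynomial.T 1)
        + constSer (cornerLin 1) * c (LaurentPolynomial.T (-1))) := by
  have hx (k : ℤ) : xypow k 0 = LaurentPolynomial.C (xpow k) := by simp [xypow]
  have hy (k : ℤ) : xypow 0 k = LaurentPolynomial.T k := by simp [xypow, xpow]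
  simp only [denomAll, sxx, cornerLin, map_sub, map_add, map_mul, map_one, constSer_s,
    constSer_c, hx, hy]
  simp only [xypow, c, map_add, map_sub, map_mul, map_one]
  ring

theorem gfAxis_expansion (N : ℕ) : ∃ K, gfAxis = ∑ j ∈ Finset.range N,
    ((2 * j).choose j : Ser Qax) * t ^ (2 * j) * (cornerFactor ^ j * invAxis ^ (2 * j + 1))
      + t ^ (2 * N) * K := by
  rw [gfAxis_eq_constTerm, constTerm_eq_zCoeff, cornerFactor_eq]
  exact zCoeff_zero_expansion one_sub_sxx_mul_invAxis
    (denomAll_eq_constSer ▸ gfAll_mul_denomAll) N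

/-- With U = 1/(1 - s(x + 1/x)) and V = t² `cornerFactor` U², the expansion of `gfAxis` agrees with
that of U(1 - 4V)^(-1/2) modulo every power of t. -/
theorem gfAxis_sq_mul_discAxis :
    gfAxis ^ 2 * discAxis = 1 ∧ constantCoeff gfAxis = 1 := by
  set V : Ser Qax := t ^ 2 * (cornerFactor * invAxis ^ 2) with hV
  have hV0 : constantCoeff V = 0 := by
    rw [hV, map_mul, map_pow, constantCoeff_t, zero_pow two_ne_zero, zero_mul]
  obtain ⟨G, hG, hG1, hexp⟩ := exists_centralBinom_expansion hV0
  have hU := one_sub_sxx_mul_invAxis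
  have hgf : gfAxis = invAxis * G := by
    refine eq_of_forall_t_pow_dvd fun N => ?_
    obtain ⟨K, hK⟩ := hexp N
    obtain ⟨K', hK'⟩ := gfAxis_expansion N
    refine ⟨t ^ N * K' - t ^ N * (invAxis * (cornerFactor * invAxis ^ 2) ^ N * K), ?_⟩
    rw [hK, hK', mul_add, Finset.mul_sum]
    have : ∀ j ∈ Finset.range N, ((2 * j).choose j : Ser Qax) * t ^ (2 * j)
        * (cornerFactor ^ j * invAxis ^ (2 * j + 1))
        = invAxis * (((2 * j).choose j : Ser Qax) * V ^ j) := by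
      intro j _
      rw [hV]
      ring
    rw [Finset.sum_congr rfl this, hV]
    ring
  constructor
  · have hdisc : discAxis * invAxis ^ 2 = 1 - 4 * V := by
      rw [discAxis, hV]
      linear_combination ((1 - sxx) * invAxis + 1) * hU
    rw [hgf]
    linear_combination hG + G ^ 2 * hdisc
  · rw [hgf, map_mul, constantCoeff_invAxis, hG1, one_mul]

theorem constantCoeff_discAxis : constantCoeff discAxis = 1 := by
  rw [discAxis, map_sub, map_pow, map_sub, constantCoeff_sxx, map_one, map_mul, map_mul, map_pow,
    constantCoeff_t, zero_pow two_ne_zero, mul_zero, zero_mul, sub_zero, sub_zero, one_pow]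

theorem exists_gfAxis_mul_eq_one : ∃ S : Ser Qax, IsSqrtSeries S discAxis ∧ gfAxis * S = 1 := by
  obtain ⟨h, h1⟩ := gfAxis_sq_mul_discAxis
  refine ⟨gfAxis * discAxis, ⟨?_, ?_⟩, ?_⟩
  · linear_combination discAxis * h
  · rw [map_mul, h1, constantCoeff_discAxis, one_mul]
  · linear_combination h

theorem constTerm_t_pow_mul (N : ℕ) (F : Ser Qax) :
    constTerm (t ^ N * F) = t ^ N * constTerm F := by
  rw [constTerm_eq_zCoeff, constTerm_eq_zCoeff, ← zCoeff_constSer_mul, map_pow, constSer_t]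

theorem constTerm_natCast_mul (m : ℕ) (F : Ser Qax) :
    constTerm ((m : Ser Qax) * F) = (m : Ser Qa) * constTerm F := by
  rw [constTerm_eq_zCoeff, constTerm_eq_zCoeff, ← zCoeff_constSer_mul, map_natCast]

theorem constTerm_eq_sumTSq {F : Ser Qax} {G : ℕ → Ser Qax}
    (h : ∀ N : ℕ, ∃ K, F = ∑ j ∈ Finset.range N, t ^ (2 * j) * G j + t ^ (2 * N) * K) :
    constTerm F = sumTSq fun j => constTerm (G j) := by
  refine eq_sumTSq fun N => ?_
  obtain ⟨K, hK⟩ := h N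
  refine ⟨t ^ N * constTerm K, ?_⟩
  rw [← mul_assoc, ← pow_add, ← two_mul, ← constTerm_t_pow_mul, hK, constTerm_eq_zCoeff, map_add,
    map_sum]
  simp only [← constTerm_eq_zCoeff, constTerm_t_pow_mul]

theorem gfLoop_eq_sumTSq :
    gfLoop = sumTSq (fun j => ((2 * j).choose j : Ser Qa) * W00 j) := by
  rw [gfLoop_eq_constTerm, constTerm_eq_sumTSq
    (G := fun j => ((2 * j).choose j : Ser Qax) * (cornerFactor ^ j * invAxis ^ (2 * j + 1)))]
  · simp only [constTerm_natCast_mul]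
    rfl
  · intro N
    obtain ⟨K, hK⟩ := gfAxis_expansion N
    refine ⟨K, ?_⟩
    rw [hK]
    simp only [mul_assoc, mul_left_comm (t ^ _)]

/-- The series of `cornerFactor`^j t^(2j) U^(2j+1), U = 1/(1 - s(x + 1/x)), is geometric with sum H;
this turns A into the constant term of a rational function. -/
theorem serA_eq_constTerm {H : Ser Qax}
    (hH : H * ((1 - sxx) ^ 2 - t ^ 2 * cornerFactor) = 1 - sxx) : serA = constTerm H := by
  symm
  have hU := one_sub_sxx_mul_invAxis
  have hrec : H = invAxis + t ^ 2 * cornerFactor * invAxis ^ 2 * H := by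
    linear_combination invAxis ^ 2 * hH
      - (H * ((1 - sxx) * invAxis + 1) - invAxis) * hU
  refine constTerm_eq_sumTSq (G := fun j => cornerFactor ^ j * invAxis ^ (2 * j + 1)) fun N =>
    ⟨cornerFactor ^ N * invAxis ^ (2 * N) * H, ?_⟩
  induction N with
  | zero => simp
  | succ N ih =>
    rw [Finset.sum_range_succ]
    refine ih.trans ?_
    linear_combination t ^ (2 * N) * cornerFactor ^ N * invAxis ^ (2 * N) * hrec

end SquareRoots

/-! ### Coefficientwise derivations -/

/-- The Leibniz rule for an additive map of a commutative ring. -/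
def IsLeibniz {A : Type*} [CommRing A] (D : A →+ A) : Prop :=
  ∀ F G, D (F * G) = F * D G + G * D F

namespace IsLeibniz

variable {A : Type*} [CommRing A] {D : A →+ A}

theorem one (h : IsLeibniz D) : D 1 = 0 := by
  have := h 1 1
  simpa using this

theorem pow_succ (h : IsLeibniz D) (F : A) (n : ℕ) : D (F ^ (n + 1)) = (n + 1) * F ^ n * D F := by
  induction n with
  | zero => simp
  | succ n ih =>
    rw [_root_.pow_succ, h, ih]
    push_cast
    ring

theorem natCast (h : IsLeibniz D) (n : ℕ) : D (n : A) = 0 := by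
  rw [← nsmul_one, map_nsmul, h.one, smul_zero]

theorem natCast_mul (h : IsLeibniz D) (n : ℕ) (F : A) : D (n * F) = n * D F := by
  rw [h, h.natCast, mul_zero, add_zero]

end IsLeibniz

section Derivations

variable {R : Type} [CommRing R]

/-- An additive map applied to the coefficients of a series. -/
def mapCoeff (d : R →+ R) : Ser R →+ Ser R where
  toFun F := (fun n => d (coeff n F) : (Fin 2 →₀ ℕ) → R)
  map_zero' := by ext n; exact map_zero d
  map_add' F G := by ext n; exact map_add d _ _

theorem coeff_mapCoeff (d : R →+ R) (F : Ser R) (n : Fin 2 →₀ ℕ) :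
    coeff n (mapCoeff d F) = d (coeff n F) := rfl

theorem IsLeibniz.mapCoeff {d : R →+ R} (h : IsLeibniz d) : IsLeibniz (mapCoeff d) := by
  classical
  intro F G
  ext n
  rw [coeff_mapCoeff, map_add, mul_comm G, coeff_mul, coeff_mul, coeff_mul, map_sum,
    ← Finset.sum_add_distrib]
  refine Finset.sum_congr rfl fun p _ => ?_
  rw [h, coeff_mapCoeff, coeff_mapCoeff, mul_comm (coeff p.2 G)]

/-- The map `∑ r_n z^n ↦ ∑ (d r_n + κ n r_n) z^n`. -/
def laurentDeriv (d : R →+ R) (κ : ℤ) : LaurentPolynomial R →+ LaurentPolynomial R where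
  toFun f := ⟨Finsupp.onFinset f.coeff.support (fun n => d (f.coeff n) + κ * n * f.coeff n)
    fun n hn => by
      rw [Finsupp.mem_support_iff]
      intro h
      simp [h] at hn⟩
  map_zero' := by ext n; simp
  map_add' f g := by
    ext n
    simp only [AddMonoidAlgebra.coeff_add, Finsupp.onFinset_apply, Finsupp.coe_add, Pi.add_apply,
      map_add]
    ring

theorem coeff_laurentDeriv (d : R →+ R) (κ : ℤ) (f : LaurentPolynomial R) (n : ℤ) :
    (laurentDeriv d κ f).coeff n = d (f.coeff n) + κ * n * f.coeff n := rfl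

theorem laurentDeriv_C_mul_T (d : R →+ R) (κ : ℤ) (r : R) (n : ℤ) :
    laurentDeriv d κ (LaurentPolynomial.C r * LaurentPolynomial.T n)
      = LaurentPolynomial.C (d r + κ * n * r) * LaurentPolynomial.T n := by
  ext m
  rw [coeff_laurentDeriv]
  simp only [← LaurentPolynomial.smul_eq_C_mul, AddMonoidAlgebra.coeff_smul_apply,
    LaurentPolynomial.T_apply]
  by_cases h : n = m
  · simp [h]
  · simp [h]

theorem IsLeibniz.laurentDeriv {d : R →+ R} (h : IsLeibniz d) (κ : ℤ) :
    IsLeibniz (laurentDeriv d κ) := by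
  intro F G
  induction F using LaurentPolynomial.induction_on' with
  | add p q hp hq => rw [add_mul, map_add, hp, hq, map_add]; ring
  | C_mul_T n r =>
    induction G using LaurentPolynomial.induction_on' with
    | add p q hp hq => rw [mul_add, map_add, hp, hq, map_add]; ring
    | C_mul_T m r' =>
      have : LaurentPolynomial.C r * LaurentPolynomial.T n
          * (LaurentPolynomial.C r' * LaurentPolynomial.T m)
          = LaurentPolynomial.C (r * r') * LaurentPolynomial.T (n + m) := by
        rw [map_mul, LaurentPolynomial.T_add]; ring
      rw [this, laurentDeriv_C_mul_T, laurentDeriv_C_mul_T, laurentDeriv_C_mul_T, h,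
        LaurentPolynomial.T_add]
      push_cast
      simp only [map_add, map_mul]
      ring

/-- The operator `z d/dz`. -/
def eulerZ : Ser (LaurentPolynomial R) →+ Ser (LaurentPolynomial R) :=
  mapCoeff (laurentDeriv 0 1)

theorem isLeibniz_zero {A : Type*} [CommRing A] : IsLeibniz (0 : A →+ A) := fun _ _ => by simp

theorem isLeibniz_eulerZ : IsLeibniz (eulerZ (R := R)) := (isLeibniz_zero.laurentDeriv 1).mapCoeff

theorem zCoeff_eulerZ (k : ℤ) (F : Ser (LaurentPolynomial R)) :
    zCoeff k (eulerZ F) = (k : Ser R) * zCoeff k F := by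
  ext n
  have : (k : Ser R) = C (k : R) := by simp
  rw [this, coeff_C_mul, coeff_zCoeff, coeff_zCoeff, eulerZ, coeff_mapCoeff, coeff_laurentDeriv]
  simp

theorem ext_zCoeff {F G : Ser (LaurentPolynomial R)} (h : ∀ k, zCoeff k F = zCoeff k G) :
    F = G := by
  refine MvPowerSeries.ext fun n => LaurentPolynomial.ext fun k => ?_
  rw [← coeff_zCoeff, h, coeff_zCoeff]

theorem zCoeff_constSer (k : ℤ) (F : Ser R) :
    zCoeff k (constSer F) = if k = 0 then F else 0 := by
  rw [← mul_one (constSer F), zCoeff_constSer_mul, zCoeff_one, mul_ite, mul_one, mul_zero]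

theorem eulerZ_constSer (F : Ser R) : eulerZ (constSer F) = 0 := by
  refine ext_zCoeff fun k => ?_
  rw [zCoeff_eulerZ, zCoeff_constSer, map_zero]
  split_ifs with h
  · rw [h, Int.cast_zero, zero_mul]
  · rw [mul_zero]

theorem eulerZ_c_T (k : ℤ) : eulerZ (c (LaurentPolynomial.T k) : Ser (LaurentPolynomial R))
    = (k : Ser (LaurentPolynomial R)) * c (LaurentPolynomial.T k) := by
  refine ext_zCoeff fun l => ?_
  have : (k : Ser (LaurentPolynomial R)) = constSer (k : Ser R) := by simp
  rw [zCoeff_eulerZ, this, zCoeff_constSer_mul, zCoeff_c_T]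
  split_ifs with h
  · rw [h]
  · simp

/-- The coefficient of z^k is multiplied by k, which is cancellable for k ≠ 0 in characteristic
zero. -/
theorem eq_constSer_of_eulerZ_eq_zero [IsDomain R] [CharZero R] {F : Ser (LaurentPolynomial R)}
    (h : eulerZ F = 0) : F = constSer (zCoeff 0 F) := by
  refine ext_zCoeff fun k => ?_
  rw [zCoeff_constSer]
  split_ifs with hk
  · rw [hk]
  · have h' := zCoeff_eulerZ k F
    rw [h, map_zero] at h'
    ext n
    have h'' := congrArg (coeff n) h'
    have hc : (k : Ser R) = C (k : R) := by simp
    rw [hc, coeff_C_mul, map_zero] at h''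
    rw [map_zero]
    exact (mul_eq_zero.mp h''.symm).resolve_left (by exact_mod_cast hk)

/-! ### Laurent polynomials with bounded exponents -/

theorem pol_smul_eq (p : Pol R) (F : Ser (LaurentPolynomial R)) :
    p • F = constSer (p : Ser R) * F := by
  rw [Algebra.smul_def]
  rfl

/-- The combinations of the monomials `z ^ i`, `i ∈ S`, with coefficients in `R[s, t]`. -/
def zSpan (R : Type) [CommRing R] (S : Set ℤ) : Submodule (Pol R) (Ser (LaurentPolynomial R)) :=
  Submodule.span (Pol R) ((fun i => c (LaurentPolynomial.T i)) '' S)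

theorem c_T_mem_zSpan {S : Set ℤ} {i : ℤ} (h : i ∈ S) :
    c (LaurentPolynomial.T i) ∈ zSpan R S :=
  Submodule.subset_span ⟨i, h, rfl⟩

theorem constSer_mul_mem_zSpan {S : Set ℤ} (p : Pol R) {F : Ser (LaurentPolynomial R)}
    (h : F ∈ zSpan R S) : constSer (p : Ser R) * F ∈ zSpan R S := by
  rw [← pol_smul_eq]
  exact Submodule.smul_mem _ _ h

theorem intCast_mul_mem_zSpan {S : Set ℤ} (m : ℤ) {F : Ser (LaurentPolynomial R)}
    (h : F ∈ zSpan R S) : (m : Ser (LaurentPolynomial R)) * F ∈ zSpan R S := by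
  rw [← zsmul_eq_mul]
  exact zsmul_mem h m

theorem mul_mem_zSpan {S S' S'' : Set ℤ} (h : ∀ i ∈ S, ∀ j ∈ S', i + j ∈ S'')
    {F G : Ser (LaurentPolynomial R)} (hF : F ∈ zSpan R S) (hG : G ∈ zSpan R S') :
    F * G ∈ zSpan R S'' := by
  have := Submodule.mul_mem_mul hF hG
  rw [zSpan, zSpan, Submodule.span_mul_span] at this
  refine Submodule.span_mono ?_ this
  rintro _ ⟨_, ⟨i, hi, rfl⟩, _, ⟨j, hj, rfl⟩, rfl⟩
  refine ⟨i + j, h i hi j hj, ?_⟩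
  simp only [c, ← map_mul, LaurentPolynomial.T_add]

theorem one_mem_zSpan {S : Set ℤ} (h : 0 ∈ S) : 1 ∈ zSpan R S := by
  have := c_T_mem_zSpan (R := R) h
  rwa [LaurentPolynomial.T_zero, c, map_one] at this

theorem zCoeff_eq_zero_of_mem_zSpan {S : Set ℤ} {k : ℤ} (hk : k ∉ S)
    {F : Ser (LaurentPolynomial R)} (hF : F ∈ zSpan R S) : zCoeff k F = 0 := by
  induction hF using Submodule.span_induction with
  | mem x hx =>
    obtain ⟨i, hi, rfl⟩ := hx
    rw [zCoeff_c_T, if_neg]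
    rintro rfl
    exact hk hi
  | zero => exact map_zero _
  | add x y _ _ hx hy => rw [map_add, hx, hy, add_zero]
  | smul p x _ hx => rw [pol_smul_eq, zCoeff_constSer_mul, hx, mul_zero]

/-- The derivation `Δ` stabilizes the spaces of Laurent polynomials. -/
structure PreservesLaurent (Δ : Ser (LaurentPolynomial R) →+ Ser (LaurentPolynomial R)) : Prop where
  leibniz : IsLeibniz Δ
  c_T : ∀ i : ℤ, ∃ m : ℤ, Δ (c (LaurentPolynomial.T i))
    = (m : Ser (LaurentPolynomial R)) * c (LaurentPolynomial.T i)
  coe : ∀ p : Pol R, ∃ q : Pol R, Δ (constSer (p : Ser R)) = constSer (q : Ser R)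

theorem PreservesLaurent.mem_zSpan {Δ : Ser (LaurentPolynomial R) →+ Ser (LaurentPolynomial R)}
    (hΔ : PreservesLaurent Δ) {S : Set ℤ} {F : Ser (LaurentPolynomial R)} (hF : F ∈ zSpan R S) :
    Δ F ∈ zSpan R S := by
  induction hF using Submodule.span_induction with
  | mem x hx =>
    obtain ⟨i, hi, rfl⟩ := hx
    obtain ⟨m, hm⟩ := hΔ.c_T i
    change Δ (c (LaurentPolynomial.T i)) ∈ _
    rw [hm]
    exact intCast_mul_mem_zSpan m (c_T_mem_zSpan hi)
  | zero => rw [map_zero]; exact zero_mem _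
  | add x y _ _ hx hy => rw [map_add]; exact add_mem hx hy
  | smul p x hx' hx =>
    obtain ⟨q, hq⟩ := hΔ.coe p
    rw [pol_smul_eq, hΔ.leibniz, hq, mul_comm x]
    exact add_mem (constSer_mul_mem_zSpan p hx) (constSer_mul_mem_zSpan q hx')

theorem preservesLaurent_eulerZ : PreservesLaurent (eulerZ (R := R)) where
  leibniz := isLeibniz_eulerZ
  c_T i := ⟨i, eulerZ_c_T i⟩
  coe p := ⟨0, by rw [eulerZ_constSer, MvPolynomial.coe_zero, map_zero]⟩

theorem isLeibniz_laurent_pderiv (i : Fin 2) :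
    IsLeibniz ((pderiv (LaurentPolynomial R) i).toLinearMap.toAddMonoidHom :
      Ser (LaurentPolynomial R) →+ Ser (LaurentPolynomial R)) := fun F G =>
  (pderiv (LaurentPolynomial R) i).leibniz F G

theorem pderiv_constSer (i : Fin 2) (F : Ser R) :
    pderiv (LaurentPolynomial R) i (constSer F) = constSer (pderiv R i F) := by
  refine MvPowerSeries.ext fun n => ?_
  change _ = coeff n (MvPowerSeries.map _ _)
  rw [coeff_pderiv, coeff_map, coeff_pderiv, map_mul, map_add, map_one, map_natCast]
  rfl

theorem preservesLaurent_pderiv (i : Fin 2) :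
    PreservesLaurent ((pderiv (LaurentPolynomial R) i).toLinearMap.toAddMonoidHom :
      Ser (LaurentPolynomial R) →+ Ser (LaurentPolynomial R)) where
  leibniz := isLeibniz_laurent_pderiv i
  c_T k := ⟨0, by
    rw [Int.cast_zero, zero_mul]
    exact pderiv_C⟩
  coe p := ⟨MvPolynomial.pderiv i p, by
    rw [← pderiv_coe]
    exact pderiv_constSer i _⟩

theorem zCoeff_zero_pderiv (i : Fin 2) (F : Ser (LaurentPolynomial R)) :
    zCoeff 0 (pderiv (LaurentPolynomial R) i F) = pderiv R i (zCoeff 0 F) := by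
  ext n
  rw [coeff_zCoeff, coeff_pderiv, coeff_pderiv, coeff_zCoeff]
  have : ((n i : LaurentPolynomial R) + 1) = LaurentPolynomial.C ((n i : R) + 1) := by simp
  rw [this, mul_comm, ← LaurentPolynomial.smul_eq_C_mul, AddMonoidAlgebra.coeff_smul_apply,
    smul_eq_mul, mul_comm]

theorem mapCoeff_constSer (d : R →+ R) (F : Ser R) :
    mapCoeff (laurentDeriv d 0) (constSer F) = constSer (mapCoeff d F) := by
  refine MvPowerSeries.ext fun n => ?_
  change laurentDeriv d 0 (coeff n (MvPowerSeries.map _ _)) = coeff n (MvPowerSeries.map _ _)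
  rw [coeff_map, coeff_map, coeff_mapCoeff, ← LaurentPolynomial.C_eq_algebraMap,
    ← mul_one (LaurentPolynomial.C (coeff n F)), ← LaurentPolynomial.T_zero, laurentDeriv_C_mul_T]
  simp

theorem mapCoeff_coe (d : R →+ R) (p : Pol R) : ∃ q : Pol R, mapCoeff d (p : Ser R) = q := by
  induction p using MvPolynomial.induction_on' with
  | monomial u r =>
    classical
    refine ⟨MvPolynomial.monomial u (d r), ?_⟩
    ext n
    rw [coeff_mapCoeff, MvPolynomial.coe_monomial, MvPolynomial.coe_monomial, coeff_monomial,
      coeff_monomial]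
    split_ifs
    · rfl
    · exact map_zero d
  | add p q hp hq =>
    obtain ⟨p', hp⟩ := hp
    obtain ⟨q', hq⟩ := hq
    exact ⟨p' + q', by rw [MvPolynomial.coe_add, map_add, hp, hq, MvPolynomial.coe_add]⟩

theorem preservesLaurent_mapCoeff {d : R →+ R} (hd : IsLeibniz d) :
    PreservesLaurent (mapCoeff (laurentDeriv d 0)) where
  leibniz := (hd.laurentDeriv 0).mapCoeff
  c_T k := ⟨0, by
    classical
    refine MvPowerSeries.ext fun n => ?_
    rw [coeff_mapCoeff, c, coeff_C, Int.cast_zero, zero_mul, map_zero]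
    split_ifs
    · rw [← one_mul (LaurentPolynomial.T k), ← map_one LaurentPolynomial.C, laurentDeriv_C_mul_T,
        hd.one]
      simp
    · exact map_zero _⟩
  coe p := by
    obtain ⟨q, hq⟩ := mapCoeff_coe d p
    exact ⟨q, by rw [mapCoeff_constSer, hq]⟩

theorem zCoeff_zero_mapCoeff (d : R →+ R) (F : Ser (LaurentPolynomial R)) :
    zCoeff 0 (mapCoeff (laurentDeriv d 0) F) = mapCoeff d (zCoeff 0 F) := by
  ext n
  rw [coeff_zCoeff, coeff_mapCoeff, coeff_mapCoeff, coeff_laurentDeriv, coeff_zCoeff]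
  simp

end Derivations

/-! ### Constant terms of inverse square roots of Laurent polynomials are D-finite -/

section InverseSqrt

variable {R : Type} [CommRing R]

/-- Differentiate F² D = 1 and multiply by F; keeping the factor 2 avoids a division. -/
theorem IsLeibniz.two_mul_of_sq_mul_eq_one {A : Type*} [CommRing A] {Δ : A →+ A}
    (hΔ : IsLeibniz Δ) {F D : A} (hF : F ^ 2 * D = 1) : 2 * Δ F = -(F ^ 3 * Δ D) := by
  have h := congrArg Δ hF
  rw [hΔ.one, hΔ, sq, hΔ] at h
  linear_combination F * h - 2 * Δ F * hF

theorem PreservesLaurent.exists_iterate_eq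
    {Δ : Ser (LaurentPolynomial R) →+ Ser (LaurentPolynomial R)} (hΔ : PreservesLaurent Δ)
    {F D : Ser (LaurentPolynomial R)} (hF : F ^ 2 * D = 1)
    (hD : D ∈ zSpan R (Set.Icc (-2) 2)) (k : ℕ) :
    ∃ N ∈ zSpan R (Set.Icc (-(2 * k : ℤ)) (2 * k)), 2 ^ k * Δ^[k] F = N * F ^ (2 * k + 1) := by
  induction k with
  | zero => exact ⟨1, one_mem_zSpan (by simp), by simp⟩
  | succ k ih =>
    obtain ⟨N, hN, h⟩ := ih
    -- The numerator of 2 Δ(N F^(2k+1)) over F^(2k+3): the term containing Δ N is multiplied by F² D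
    -- = 1, and 2 Δ F = -F³ Δ D.
    refine ⟨((2 : ℤ) : Ser (LaurentPolynomial R)) * (Δ N * D)
      - ((2 * k + 1 : ℤ) : Ser (LaurentPolynomial R)) * (N * Δ D), ?_, ?_⟩
    · have hadd : ∀ i ∈ Set.Icc (-(2 * k : ℤ)) (2 * k), ∀ j ∈ Set.Icc (-2 : ℤ) 2,
          i + j ∈ Set.Icc (-(2 * (k + 1 : ℕ) : ℤ)) (2 * (k + 1 : ℕ)) := by
        intro i hi j hj
        simp only [Set.mem_Icc] at hi hj ⊢
        omega
      exact sub_mem (intCast_mul_mem_zSpan _ (mul_mem_zSpan hadd (hΔ.mem_zSpan hN) hD))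
        (intCast_mul_mem_zSpan _ (mul_mem_zSpan hadd hN (hΔ.mem_zSpan hD)))
    · have h' := congrArg Δ h
      have hpow : Δ ((2 : Ser (LaurentPolynomial R)) ^ k * Δ^[k] F) = 2 ^ k * Δ^[k + 1] F := by
        have := hΔ.leibniz.natCast_mul (2 ^ k) (Δ^[k] F)
        rw [Function.iterate_succ_apply']
        exact_mod_cast this
      rw [hpow, hΔ.leibniz, hΔ.leibniz.pow_succ] at h'
      have h2 := hΔ.leibniz.two_mul_of_sq_mul_eq_one hF
      push_cast at h' ⊢
      linear_combination 2 * h' + N * (2 * k + 1) * F ^ (2 * k) * h2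
        - 2 * F ^ (2 * k + 1) * Δ N * hF

theorem zCoeff_sum_c_T (I : Finset ℤ) (q : ℤ → Ser R) (k : ℤ) (hk : k ∈ I) :
    zCoeff k (∑ i ∈ I, constSer (q i) * c (LaurentPolynomial.T i)) = q k := by
  rw [map_sum, Finset.sum_eq_single k]
  · rw [zCoeff_constSer_mul, zCoeff_c_T, if_pos rfl, mul_one]
  · intro i _ hi
    rw [zCoeff_constSer_mul, zCoeff_c_T, if_neg (Ne.symm hi), mul_zero]
  · exact fun h => absurd hk h

/-- D has leading term σ z², hence D^k has leading term σ^k z^(2k). -/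
theorem pow_sub_mem_zSpan {D : Ser (LaurentPolynomial R)} {σ : Pol R}
    (hD : D - constSer (σ : Ser R) * c (LaurentPolynomial.T 2) ∈ zSpan R (Set.Iic 1)) (k : ℕ) :
    D ^ k - constSer (σ : Ser R) ^ k * c (LaurentPolynomial.T (2 * k))
      ∈ zSpan R (Set.Iic (2 * k - 1)) := by
  induction k with
  | zero =>
    have : (c (LaurentPolynomial.T (2 * (0 : ℕ))) : Ser (LaurentPolynomial R)) = 1 := by simp [c]
    rw [this, pow_zero, pow_zero, mul_one, sub_self]
    exact zero_mem _
  | succ k ih =>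
    have hadd {m n l : ℤ} (h : m + n ≤ l) : ∀ i ∈ Set.Iic m, ∀ j ∈ Set.Iic n, i + j ∈ Set.Iic l :=
      fun i hi j hj => (add_le_add hi hj).trans h
    have hT : (c (LaurentPolynomial.T (2 * (k + 1 : ℕ))) : Ser (LaurentPolynomial R))
        = c (LaurentPolynomial.T (2 * k)) * c (LaurentPolynomial.T 2) := by
      rw [c, c, c, ← map_mul, ← LaurentPolynomial.T_add]
      congr 2
    have hσ : constSer (σ : Ser R) ^ k = constSer ((σ ^ k : Pol R) : Ser R) := by
      rw [MvPolynomial.coe_pow, map_pow]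
    have h1 : constSer (σ : Ser R) * c (LaurentPolynomial.T 2) ∈ zSpan R (Set.Iic 2) :=
      constSer_mul_mem_zSpan σ (c_T_mem_zSpan Set.self_mem_Iic)
    have h2 : constSer (σ : Ser R) ^ k * c (LaurentPolynomial.T (2 * k))
        ∈ zSpan R (Set.Iic (2 * k)) := by
      rw [hσ]
      exact constSer_mul_mem_zSpan _ (c_T_mem_zSpan Set.self_mem_Iic)
    have h3 := add_mem (add_mem
      (mul_mem_zSpan (hadd (l := 2 * (k + 1 : ℕ) - 1) (by push_cast; omega)) ih hD)
      (mul_mem_zSpan (hadd (by push_cast; omega)) ih h1))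
      (mul_mem_zSpan (hadd (by push_cast; omega)) h2 hD)
    convert h3 using 1
    rw [hT]
    ring

theorem zCoeff_pow_of_sub_mem {D : Ser (LaurentPolynomial R)} {σ : Pol R}
    (hD : D - constSer (σ : Ser R) * c (LaurentPolynomial.T 2) ∈ zSpan R (Set.Iic 1)) (k : ℕ) :
    zCoeff (2 * k) (D ^ k) = (σ : Ser R) ^ k := by
  have h := zCoeff_eq_zero_of_mem_zSpan (k := 2 * k) (by simp) (pow_sub_mem_zSpan hD k)
  rw [map_sub, ← map_pow, zCoeff_constSer_mul, zCoeff_c_T, if_pos rfl, mul_one] at h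
  exact sub_eq_zero.mp h

/-- The space of Laurent polynomials is too small for the derivatives of `F = D^(-1/2)` and the
`z`-derivatives of the `z ^ i * F ^ 7` to be independent. -/
theorem PreservesLaurent.exists_relation [IsDomain R]
    {Δ : Ser (LaurentPolynomial R) →+ Ser (LaurentPolynomial R)} (hΔ : PreservesLaurent Δ)
    {F D : Ser (LaurentPolynomial R)} (hF : F ^ 2 * D = 1)
    (hD : D ∈ zSpan R (Set.Icc (-2) 2)) :
    ∃ (p : ℕ → Pol R) (q : ℤ → Pol R),
      ((∃ k < 5, p k ≠ 0) ∨ ∃ i ∈ Finset.Icc (-6 : ℤ) 6, q i ≠ 0) ∧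
      ∑ k ∈ Finset.range 5, constSer (p k : Ser R) * (2 ^ k * Δ^[k] F)
        + 2 * eulerZ ((∑ i ∈ Finset.Icc (-6 : ℤ) 6,
            constSer (q i : Ser R) * c (LaurentPolynomial.T i)) * F ^ 7) = 0 := by
  classical
  choose N hN hNF using hΔ.exists_iterate_eq hF hD
  -- Numerators over the common power F^9: `M k` comes from 2^k Δ^k F, with exponents bounded by 2k
  -- + 2(4 - k) = 8, and `E i` from twice the Euler derivative of z^i F^7, with exponents in i +
  -- [-2, 2].
  let M : Fin 5 → Ser (LaurentPolynomial R) := fun k => N k * D ^ (4 - (k : ℕ))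
  let E : Finset.Icc (-6 : ℤ) 6 → Ser (LaurentPolynomial R) := fun i =>
    ((2 * i : ℤ) : Ser (LaurentPolynomial R)) * (c (LaurentPolynomial.T i) * D)
      - ((7 : ℤ) : Ser (LaurentPolynomial R)) * (c (LaurentPolynomial.T i) * eulerZ D)
  have hDpow : ∀ n : ℕ, D ^ n ∈ zSpan R (Set.Icc (-(2 * n : ℤ)) (2 * n)) := by
    intro n
    induction n with
    | zero => exact one_mem_zSpan (by simp)
    | succ n ih =>
      rw [pow_succ]
      refine mul_mem_zSpan ?_ ih hD
      intro i hi j hj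
      simp only [Set.mem_Icc] at hi hj ⊢
      omega
  have hM : ∀ k, M k ∈ zSpan R (Set.Icc (-8) 8) := by
    intro k
    refine mul_mem_zSpan ?_ (hN k) (hDpow _)
    intro i hi j hj
    have := k.isLt
    simp only [Set.mem_Icc] at hi hj ⊢
    omega
  have hE : ∀ i, E i ∈ zSpan R (Set.Icc (-8) 8) := by
    intro i
    have hi := Finset.mem_Icc.mp i.2
    have hadd : ∀ j ∈ ({(i : ℤ)} : Set ℤ), ∀ l ∈ Set.Icc (-2 : ℤ) 2, j + l ∈ Set.Icc (-8 : ℤ) 8 := by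
      intro j hj l hl
      simp only [Set.mem_Icc, Set.mem_singleton_iff] at hj hl ⊢
      omega
    exact sub_mem (intCast_mul_mem_zSpan _ (mul_mem_zSpan hadd (c_T_mem_zSpan rfl) hD))
      (intCast_mul_mem_zSpan _ (mul_mem_zSpan hadd (c_T_mem_zSpan rfl)
        (preservesLaurent_eulerZ.mem_zSpan hD)))
  -- 5 + 13 = 18 elements lie in a span of at most 17 monomials.
  have hdep : ¬ LinearIndependent (Pol R) (Sum.elim M E) := by
    intro hli
    have hcard := linearIndependent_le_span_aux' (Sum.elim M E) hli
      (((Finset.Icc (-8 : ℤ) 8).image fun i => c (LaurentPolynomial.T i) :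
        Finset (Ser (LaurentPolynomial R))) : Set (Ser (LaurentPolynomial R))) (by
        rintro _ ⟨k | i, rfl⟩
        · simpa [zSpan] using hM k
        · simpa [zSpan] using hE i)
    have h1 : Fintype.card (Fin 5 ⊕ Finset.Icc (-6 : ℤ) 6) = 18 := by
      rw [Fintype.card_sum, Fintype.card_fin, Fintype.card_coe, Int.card_Icc]
      rfl
    have h2 : ((Finset.Icc (-8 : ℤ) 8).image fun i =>
        (c (LaurentPolynomial.T i) : Ser (LaurentPolynomial R))).card ≤ 17 :=
      Finset.card_image_le.trans (by rw [Int.card_Icc]; rfl)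
    have h3 := hcard.trans (le_of_eq (Fintype.card_coe _))
    omega
  rw [Fintype.not_linearIndependent_iff] at hdep
  obtain ⟨g, hg, hg0⟩ := hdep
  refine ⟨fun k => if hk : k < 5 then g (Sum.inl ⟨k, hk⟩) else 0,
    fun i => if hi : i ∈ Finset.Icc (-6 : ℤ) 6 then g (Sum.inr ⟨i, hi⟩) else 0, ?_, ?_⟩
  · obtain ⟨k | i, h⟩ := hg0
    · exact Or.inl ⟨k, k.isLt, by simpa using h⟩
    · exact Or.inr ⟨i, i.2, by
        simp only [dif_pos i.2]
        exact h⟩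
  · have hMF : ∀ k : Fin 5, 2 ^ (k : ℕ) * Δ^[k] F = M k * F ^ 9 := by
      intro k
      have h9 : F ^ 9 = F ^ (2 * (k : ℕ) + 1) * (F ^ 2) ^ (4 - (k : ℕ)) := by
        rw [← pow_mul, ← pow_add]
        congr 1
        have := k.isLt
        omega
      have h1 : D ^ (4 - (k : ℕ)) * (F ^ 2) ^ (4 - (k : ℕ)) = 1 := by
        rw [← mul_pow, mul_comm, hF, one_pow]
      rw [hNF, h9]
      linear_combination -(N k * F ^ (2 * (k : ℕ) + 1)) * h1
    have hEF : ∀ i : Finset.Icc (-6 : ℤ) 6,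
        2 * eulerZ (c (LaurentPolynomial.T (i : ℤ)) * F ^ 7) = E i * F ^ 9 := by
      intro i
      have h2 := isLeibniz_eulerZ.two_mul_of_sq_mul_eq_one hF
      have h7 : eulerZ (F ^ 7) = 7 * F ^ 6 * eulerZ F := by
        have := isLeibniz_eulerZ.pow_succ F 6
        norm_num at this
        exact this
      rw [isLeibniz_eulerZ, eulerZ_c_T, h7]
      simp only [E]
      push_cast
      linear_combination 7 * F ^ 6 * c (LaurentPolynomial.T (i : ℤ)) * h2
        - 2 * (i : ℤ) * c (LaurentPolynomial.T (i : ℤ)) * F ^ 7 * hF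
    rw [Fintype.sum_sum_type] at hg
    simp only [Sum.elim_inl, Sum.elim_inr, pol_smul_eq] at hg
    rw [Finset.sum_range, Finset.sum_mul, map_sum, Finset.mul_sum,
      ← Finset.sum_coe_sort (Finset.Icc (-6 : ℤ) 6)]
    have he (p : Ser R) (i : Finset.Icc (-6 : ℤ) 6) :
        2 * eulerZ (constSer p * c (LaurentPolynomial.T (i : ℤ)) * F ^ 7)
          = constSer p * E i * F ^ 9 := by
      rw [mul_assoc, isLeibniz_eulerZ, eulerZ_constSer, mul_zero, add_zero, mul_left_comm, hEF,
        mul_assoc]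
    simp only [Fin.is_lt, dite_true, Finset.coe_mem, hMF, he, ← mul_assoc]
    rw [← Finset.sum_mul, ← Finset.sum_mul, ← add_mul]
    simp only [Fin.eta, Subtype.coe_eta]
    rw [hg, zero_mul]

/-- A product of a nonzero Laurent polynomial and of `D^(-7/2)` is not a constant. -/
theorem eq_zero_of_eulerZ_mul_eq_zero [IsDomain R] [CharZero R] {F D : Ser (LaurentPolynomial R)}
    (hF : F ^ 2 * D = 1) {σ : Pol R} (hσ : σ ≠ 0)
    (hD : D - constSer (σ : Ser R) * c (LaurentPolynomial.T 2) ∈ zSpan R (Set.Iic 1))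
    {Q : Ser (LaurentPolynomial R)} (hQ : Q ∈ zSpan R (Set.Icc (-6) 6))
    (h : eulerZ (Q * F ^ 7) = 0) : Q = 0 := by
  have hG := eq_constSer_of_eulerZ_eq_zero h
  set G := zCoeff 0 (Q * F ^ 7)
  have h7 : (F ^ 2 * D) ^ 7 = 1 := by rw [hF, one_pow]
  have hQ2 : Q * Q = constSer (G ^ 2) * D ^ 7 := by
    rw [map_pow, ← hG]
    linear_combination -(Q * Q) * h7
  -- If Q F^7 is the constant G, then Q² = G² D^7. The right side has coefficient G² σ^7 at z^14,
  -- whereas Q² has no exponent above 12.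
  have h14 : zCoeff 14 (Q * Q) = 0 := by
    refine zCoeff_eq_zero_of_mem_zSpan (S := Set.Icc (-12) 12) (by simp) (mul_mem_zSpan ?_ hQ hQ)
    intro i hi j hj
    simp only [Set.mem_Icc] at hi hj ⊢
    omega
  have hD7 : zCoeff 14 (D ^ 7) = (σ : Ser R) ^ 7 := zCoeff_pow_of_sub_mem hD 7
  rw [hQ2, zCoeff_constSer_mul, hD7, mul_eq_zero] at h14
  have hσ' : (σ : Ser R) ≠ 0 := fun h0 => hσ (MvPolynomial.coe_injective _ _ (by
    rw [h0, MvPolynomial.coe_zero]))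
  have hG0 : G = 0 := by
    rcases h14 with h | h
    · exact pow_eq_zero_iff two_ne_zero |>.mp h
    · exact absurd h (pow_ne_zero _ hσ')
  rw [hG0, map_zero] at hG
  linear_combination F ^ 7 * D ^ 7 * hG - Q * h7

/-- Constant terms of Euler derivatives vanish and [z^0] intertwines Δ with δ, so the relation among
the derivatives of F descends to its constant term. -/
theorem PreservesLaurent.exists_equation [IsDomain R] [CharZero R]
    {Δ : Ser (LaurentPolynomial R) →+ Ser (LaurentPolynomial R)} (hΔ : PreservesLaurent Δ)
    {δ : Ser R → Ser R} (hδ : ∀ G, zCoeff 0 (Δ G) = δ (zCoeff 0 G))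
    {F D : Ser (LaurentPolynomial R)} (hF : F ^ 2 * D = 1)
    (hD : D ∈ zSpan R (Set.Icc (-2) 2)) {σ : Pol R} (hσ : σ ≠ 0)
    (hDσ : D - constSer (σ : Ser R) * c (LaurentPolynomial.T 2) ∈ zSpan R (Set.Iic 1)) :
    ∃ p : ℕ → Pol R, (∃ k < 5, p k ≠ 0) ∧
      ∑ k ∈ Finset.range 5, (p k : Ser R) * δ^[k] (zCoeff 0 F) = 0 := by
  obtain ⟨p, q, hpq, h⟩ := hΔ.exists_relation hF hD
  have hiter (k : ℕ) (G : Ser (LaurentPolynomial R)) :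
      zCoeff 0 (Δ^[k] G) = δ^[k] (zCoeff 0 G) := by
    induction k generalizing G with
    | zero => rfl
    | succ k ih => rw [Function.iterate_succ_apply, ih, hδ, Function.iterate_succ_apply]
  refine ⟨fun k => p k * 2 ^ k, ?_, ?_⟩
  · by_contra! hp
    have hp0 : ∀ k < 5, p k = 0 := fun k hk =>
      (mul_eq_zero.mp (hp k hk)).resolve_right (pow_ne_zero _ two_ne_zero)
    obtain ⟨i, hi, hqi⟩ := hpq.resolve_left (by
      rintro ⟨k, hk, h0⟩
      exact h0 (hp0 k hk))
    rw [Finset.sum_eq_zero, zero_add] at h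
    · have hQ : ∑ j ∈ Finset.Icc (-6 : ℤ) 6, constSer (q j : Ser R) * c (LaurentPolynomial.T j)
          ∈ zSpan R (Set.Icc (-6) 6) :=
        Submodule.sum_mem _ fun j hj => constSer_mul_mem_zSpan (q j)
          (c_T_mem_zSpan (Finset.mem_Icc.mp hj))
      have h0 := congrArg (zCoeff i)
        (eq_zero_of_eulerZ_mul_eq_zero hF hσ hDσ hQ (ext_zCoeff fun k => ?_))
      · rw [map_zero, zCoeff_sum_c_T _ (fun i => (q i : Ser R)) i hi] at h0
        exact hqi (MvPolynomial.coe_injective _ _ (by rw [h0, MvPolynomial.coe_zero]))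
      · have h2 := congrArg (zCoeff k) h
        rw [two_mul, map_add, map_zero, ← two_mul] at h2
        rw [map_zero]
        refine (mul_eq_zero.mp h2).resolve_left fun h2 => ?_
        have := congrArg (constantCoeff (σ := Fin 2) (R := R)) h2
        rw [map_ofNat, map_zero] at this
        exact two_ne_zero this
    · intro k hk
      rw [hp0 k (Finset.mem_range.mp hk), MvPolynomial.coe_zero, map_zero, zero_mul]
  · have h0 := congrArg (zCoeff 0) h
    rw [map_add, map_sum, map_zero, two_mul, map_add, zCoeff_eulerZ, Int.cast_zero, zero_mul,
      add_zero, add_zero] at h0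
    rw [← h0]
    refine Finset.sum_congr rfl fun k _ => ?_
    have h2 : (2 : Ser (LaurentPolynomial R)) ^ k = constSer (2 ^ k) := by
      rw [map_pow, map_ofNat]
    have h2' : ((2 : Pol R) : Ser R) = 2 :=
      map_ofNat (MvPolynomial.coeToMvPowerSeries.ringHom (σ := Fin 2) (R := R)) 2
    rw [zCoeff_constSer_mul, h2, zCoeff_constSer_mul, hiter, MvPolynomial.coe_mul,
      MvPolynomial.coe_pow, h2', mul_assoc]

end InverseSqrt

/-- Trailing zero coefficients are dropped, since `SatisfiesLDE` requires a nonzero leading one. -/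
theorem satisfiesLDE_of_sum_eq_zero {δ : Ser Qa → Ser Qa} {F : Ser Qa} (p : ℕ → Pol Qa) (n : ℕ)
    (hp : ∃ k < n, p k ≠ 0) (h : ∑ k ∈ Finset.range n, (p k : Ser Qa) * δ^[k] F = 0) :
    SatisfiesLDE δ F := by
  induction n with
  | zero =>
    obtain ⟨k, hk, -⟩ := hp
    omega
  | succ n ih =>
    by_cases hn : p n = 0
    · refine ih ?_ ?_
      · obtain ⟨k, hk, hk0⟩ := hp
        refine ⟨k, lt_of_le_of_ne (Nat.lt_succ_iff.mp hk) ?_, hk0⟩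
        rintro rfl
        exact hk0 hn
      · rwa [Finset.sum_range_succ, hn, MvPolynomial.coe_zero, zero_mul, add_zero] at h
    · exact ⟨n, p, hn, h⟩

/-! ### The discriminant -/

/-- The discriminant is a Laurent polynomial in `x` of degree and valuation at most `2`. -/
theorem discAxis_eq :
    discAxis = constSer (s ^ 2) * c (LaurentPolynomial.T 2)
      + constSer (2 * s ^ 2 + 1 - 4 * t ^ 2 * (1 + s ^ 2 * c (a - 1) ^ 2)) * 1
      + constSer (s ^ 2) * c (LaurentPolynomial.T (-2))
      - constSer (2 * s + 4 * t ^ 2 * s * c (a - 1)) * c (LaurentPolynomial.T 1)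
      - constSer (2 * s + 4 * t ^ 2 * s * c (a - 1)) * c (LaurentPolynomial.T (-1)) := by
  have h1 : (c (LaurentPolynomial.T 1) : Ser Qax) * c (LaurentPolynomial.T (-1)) = 1 := by
    rw [c, c, ← map_mul, ← LaurentPolynomial.T_add]
    simp
  have h2 : (c (LaurentPolynomial.T 2) : Ser Qax) = c (LaurentPolynomial.T 1) ^ 2 := by
    rw [c, c, ← map_pow, LaurentPolynomial.T_pow]
    rfl
  have h3 : (c (LaurentPolynomial.T (-2)) : Ser Qax) = c (LaurentPolynomial.T (-1)) ^ 2 := by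
    rw [c, c, ← map_pow, LaurentPolynomial.T_pow]
    rfl
  have h4 (k : ℤ) : c (xpow k * LaurentPolynomial.C (a - 1))
      = c (LaurentPolynomial.T k) * constSer (c (a - 1)) := by
    rw [constSer_c, c, c, c, ← map_mul]
    rfl
  have h5 : c (xpow 1 + xpow (-1)) = c (LaurentPolynomial.T 1) + c (LaurentPolynomial.T (-1)) := by
    rw [c, map_add]
    rfl
  rw [discAxis, cornerFactor, sxx, h2, h3, h4, h4, h5]
  simp only [map_add, map_mul, map_pow, map_sub, map_one, map_ofNat, constSer_s, constSer_t]
  linear_combination (2 * s ^ 2 - 4 * t ^ 2 * s ^ 2 * constSer (c (a - 1)) ^ 2) * h1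

/-- The series in `s, t` that are polynomials. -/
def polySubring (R : Type) [CommRing R] : Subring (Ser R) :=
  (MvPolynomial.coeToMvPowerSeries.ringHom (σ := Fin 2) (R := R)).range

theorem s_mem_polySubring {R : Type} [CommRing R] : s ∈ polySubring R :=
  ⟨MvPolynomial.X 0, MvPolynomial.coe_X 0⟩

theorem t_mem_polySubring {R : Type} [CommRing R] : t ∈ polySubring R :=
  ⟨MvPolynomial.X 1, MvPolynomial.coe_X 1⟩

theorem c_mem_polySubring {R : Type} [CommRing R] (r : R) : c r ∈ polySubring R :=
  ⟨MvPolynomial.C r, MvPolynomial.coe_C r⟩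

theorem constSer_mul_mem_zSpan_of_mem {R : Type} [CommRing R] {S : Set ℤ} {P : Ser R}
    (hP : P ∈ polySubring R) {F : Ser (LaurentPolynomial R)} (h : F ∈ zSpan R S) :
    constSer P * F ∈ zSpan R S := by
  obtain ⟨p, rfl⟩ := hP
  exact constSer_mul_mem_zSpan p h

theorem discAxis_coeff_mem_polySubring :
    2 * s ^ 2 + 1 - 4 * t ^ 2 * (1 + s ^ 2 * c (a - 1) ^ 2) ∈ polySubring Qa ∧
      2 * s + 4 * t ^ 2 * s * c (a - 1) ∈ polySubring Qa := by
  have hs := s_mem_polySubring (R := Qa)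
  have ht := t_mem_polySubring (R := Qa)
  have ha := c_mem_polySubring (a - 1)
  have h2 : (2 : Ser Qa) ∈ polySubring Qa := ofNat_mem _ 2
  have h4 : (4 : Ser Qa) ∈ polySubring Qa := ofNat_mem _ 4
  constructor
  · exact sub_mem (add_mem (mul_mem h2 (pow_mem hs 2)) (one_mem _)) (mul_mem (mul_mem h4
      (pow_mem ht 2)) (add_mem (one_mem _) (mul_mem (pow_mem hs 2) (pow_mem ha 2))))
  · exact add_mem (mul_mem h2 hs) (mul_mem (mul_mem (mul_mem h4 (pow_mem ht 2)) hs) ha)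

theorem discAxis_mem_zSpan : discAxis ∈ zSpan Qa (Set.Icc (-2) 2) := by
  have hs2 := pow_mem (s_mem_polySubring (R := Qa)) 2
  obtain ⟨h0, h1⟩ := discAxis_coeff_mem_polySubring
  rw [discAxis_eq]
  exact sub_mem (sub_mem (add_mem (add_mem
    (constSer_mul_mem_zSpan_of_mem hs2 (c_T_mem_zSpan (by simp)))
    (constSer_mul_mem_zSpan_of_mem h0 (one_mem_zSpan (by simp))))
    (constSer_mul_mem_zSpan_of_mem hs2 (c_T_mem_zSpan (by simp))))
    (constSer_mul_mem_zSpan_of_mem h1 (c_T_mem_zSpan (by simp))))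
    (constSer_mul_mem_zSpan_of_mem h1 (c_T_mem_zSpan (by simp)))

theorem discAxis_sub_mem_zSpan :
    discAxis - constSer ((MvPolynomial.X 0 ^ 2 : Pol Qa) : Ser Qa) * c (LaurentPolynomial.T 2)
      ∈ zSpan Qa (Set.Iic 1) := by
  have hs2 := pow_mem (s_mem_polySubring (R := Qa)) 2
  obtain ⟨h0, h1⟩ := discAxis_coeff_mem_polySubring
  have hX : ((MvPolynomial.X 0 ^ 2 : Pol Qa) : Ser Qa) = s ^ 2 := by
    rw [MvPolynomial.coe_pow, MvPolynomial.coe_X]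
    rfl
  rw [discAxis_eq, hX, add_assoc, add_sub_assoc, add_sub_assoc, add_sub_cancel_left]
  exact sub_mem (sub_mem (add_mem
    (constSer_mul_mem_zSpan_of_mem h0 (one_mem_zSpan (by simp)))
    (constSer_mul_mem_zSpan_of_mem hs2 (c_T_mem_zSpan (by simp))))
    (constSer_mul_mem_zSpan_of_mem h1 (c_T_mem_zSpan (by simp))))
    (constSer_mul_mem_zSpan_of_mem h1 (c_T_mem_zSpan (by simp)))

theorem satisfiesLDE_gfLoop {Δ : Ser Qax →+ Ser Qax} (hΔ : PreservesLaurent Δ)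
    {δ : Ser Qa → Ser Qa} (hδ : ∀ G, zCoeff 0 (Δ G) = δ (zCoeff 0 G)) :
    SatisfiesLDE δ gfLoop := by
  obtain ⟨p, hp, h⟩ := hΔ.exists_equation hδ gfAxis_sq_mul_discAxis.1 discAxis_mem_zSpan
    (pow_ne_zero 2 (MvPolynomial.X_ne_zero 0)) discAxis_sub_mem_zSpan
  rw [gfLoop_eq_constTerm, constTerm_eq_zCoeff]
  exact satisfiesLDE_of_sum_eq_zero p 5 hp h

theorem isDFinite_gfLoop : IsDFinite gfLoop := by
  have hd : IsLeibniz (Polynomial.derivative (R := ℚ)).toAddMonoidHom := fun p q => by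
    change Polynomial.derivative (p * q) = p * Polynomial.derivative q + q * Polynomial.derivative p
    rw [Polynomial.derivative_mul]
    ring
  exact ⟨satisfiesLDE_gfLoop (preservesLaurent_mapCoeff hd) (zCoeff_zero_mapCoeff _),
    satisfiesLDE_gfLoop (preservesLaurent_pderiv 0) (zCoeff_zero_pderiv 0),
    satisfiesLDE_gfLoop (preservesLaurent_pderiv 1) (zCoeff_zero_pderiv 1)⟩

/-! ### Algebraicity of the generating function of walks ending on the axis -/

theorem isAlgebraicSeries_of_sq_mul_eq_one {R : Type} [CommRing R] [Nontrivial R] {F D : Ser R}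
    (hD : D ∈ polySubring R) (h : F ^ 2 * D = 1) : IsAlgebraicSeries F := by
  obtain ⟨p, rfl⟩ := hD
  refine ⟨Polynomial.C p * Polynomial.X ^ 2 - 1, ?_, ?_⟩
  · intro h0
    have := congrArg (Polynomial.eval 0) h0
    simp at this
  · rw [map_sub, map_mul, map_pow, Polynomial.aeval_X, Polynomial.aeval_C, map_one, mul_comm,
      algebraMap_apply', Algebra.algebraMap_self, map_id, RingHom.id_apply]
    exact sub_eq_zero.mpr h

theorem isAlgebraicSeries_gfAxis : IsAlgebraicSeries gfAxis := by
  refine isAlgebraicSeries_of_sq_mul_eq_one ?_ gfAxis_sq_mul_discAxis.1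
  have hs := s_mem_polySubring (R := Qax)
  have h4 : (4 : Ser Qax) ∈ polySubring Qax := ofNat_mem _ 4
  have hl (r : Qax) : 1 + s * c r ∈ polySubring Qax :=
    add_mem (one_mem _) (mul_mem hs (c_mem_polySubring r))
  exact sub_mem (pow_mem (sub_mem (one_mem _) (mul_mem hs (c_mem_polySubring _))) 2)
    (mul_mem (mul_mem h4 (pow_mem t_mem_polySubring 2)) (mul_mem (hl _) (hl _)))

/-! ### Constant terms by partial fractions -/

section PartialFractions

variable {R : Type} [CommRing R]

/-- The substitution `z ↦ z⁻¹`. -/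
def invertSer : Ser (LaurentPolynomial R) →+* Ser (LaurentPolynomial R) :=
  MvPowerSeries.map (LaurentPolynomial.invert (R := R)).toRingEquiv.toRingHom

theorem zCoeff_invertSer (k : ℤ) (F : Ser (LaurentPolynomial R)) :
    zCoeff k (invertSer F) = zCoeff (-k) F := by
  ext n
  rw [coeff_zCoeff, coeff_zCoeff, invertSer, coeff_map]
  exact LaurentPolynomial.invert_apply _ _

theorem invertSer_c_T (k : ℤ) :
    invertSer (c (LaurentPolynomial.T k) : Ser (LaurentPolynomial R))
      = c (LaurentPolynomial.T (-k)) := by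
  rw [invertSer, c, map_C]
  exact congrArg c (LaurentPolynomial.invert_T k)

theorem invertSer_constSer (F : Ser R) : invertSer (constSer F) = constSer F := by
  refine ext_zCoeff fun k => ?_
  rw [zCoeff_invertSer, zCoeff_constSer, zCoeff_constSer]
  simp

/-- Series whose coefficients are polynomials in `z`. -/
def toLaurentSer : Ser (Polynomial R) →+* Ser (LaurentPolynomial R) :=
  MvPowerSeries.map Polynomial.toLaurent

theorem zCoeff_toLaurentSer_of_neg {k : ℤ} (hk : k < 0) (F : Ser (Polynomial R)) :
    zCoeff k (toLaurentSer F) = 0 := by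
  ext n
  rw [coeff_zCoeff, toLaurentSer, coeff_map, LaurentPolynomial.coeff_toLaurent, map_zero]
  refine Finsupp.mapDomain_of_notMem_range _ _ ?_
  rintro ⟨m, hm⟩
  simp at hm
  omega

/-- The inverse is taken over R[z], where the constant term in s, t is 1, and then mapped to R[z,
z⁻¹]; hence it has no negative power of z. -/
theorem exists_inverse_of_quadratic {σ π : Ser R} (hσ : constantCoeff σ = 0)
    (hπ : constantCoeff π = 0) : ∃ P : Ser (LaurentPolynomial R),
      P * (1 - constSer σ * c (LaurentPolynomial.T 1) + constSer π * c (LaurentPolynomial.T 2)) = 1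
        ∧ ∀ k : ℤ, k < 0 → zCoeff k P = 0 := by
  set κ : Ser R →+* Ser (Polynomial R) := MvPowerSeries.map Polynomial.C with hκ
  have hκc (F : Ser R) : toLaurentSer (κ F) = constSer F := by
    refine MvPowerSeries.ext fun n => ?_
    change _ = coeff n (MvPowerSeries.map _ _)
    rw [toLaurentSer, hκ, coeff_map, coeff_map, coeff_map, Polynomial.toLaurent_C]
    rfl
  set p : Ser (Polynomial R) := 1 - κ σ * c Polynomial.X + κ π * c (Polynomial.X ^ 2) with hp
  have hp1 : constantCoeff p = ((1 : (Polynomial R)ˣ) : Polynomial R) := by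
    have h (F : Ser R) : constantCoeff (κ F) = Polynomial.C (constantCoeff F) :=
      constantCoeff_map _ _
    rw [hp, map_add, map_sub, map_mul, map_mul, h, h, hσ, hπ]
    simp
  have hpL : toLaurentSer p
      = 1 - constSer σ * c (LaurentPolynomial.T 1) + constSer π * c (LaurentPolynomial.T 2) := by
    have h (f : Polynomial R) : toLaurentSer (c f) = c (Polynomial.toLaurent f) := by
      rw [toLaurentSer, c, map_C]
      rfl
    rw [hp, map_add, map_sub, map_mul, map_mul, hκc, hκc, h, h, map_one, Polynomial.toLaurent_X,
      Polynomial.toLaurent_X_pow]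
    rfl
  refine ⟨toLaurentSer (invOfUnit p 1), ?_, fun k hk => zCoeff_toLaurentSer_of_neg hk _⟩
  rw [← hpL, ← map_mul, mul_comm, mul_invOfUnit p 1 hp1, map_one]

theorem c_T_mul_c_T (k l : ℤ) : (c (LaurentPolynomial.T k) : Ser (LaurentPolynomial R))
    * c (LaurentPolynomial.T l) = c (LaurentPolynomial.T (k + l)) := by
  rw [c, c, c, ← map_mul, LaurentPolynomial.T_add]

/-- Constant term of a rational function of `z` with a symmetric denominator
`(1 - σ z + π z²) (1 - σ z⁻¹ + π z⁻²)`. -/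
theorem exists_zCoeff_zero_eq {σ π α b₁ b₂ : Ser R} (hσ : constantCoeff σ = 0)
    (hπ : constantCoeff π = 0) :
    ∃ H : Ser (LaurentPolynomial R), zCoeff 0 H = α ∧
      H * ((1 - constSer σ * c (LaurentPolynomial.T 1) + constSer π * c (LaurentPolynomial.T 2))
          * (1 - constSer σ * c (LaurentPolynomial.T (-1))
            + constSer π * c (LaurentPolynomial.T (-2))))
        = constSer (α * (1 + σ ^ 2 + π ^ 2) - 2 * σ * b₁ + 2 * π * b₂)
          + constSer (-(α * σ * (1 + π)) + b₁ * (1 + π) - σ * b₂)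
            * (c (LaurentPolynomial.T 1) + c (LaurentPolynomial.T (-1)))
          + constSer (α * π + b₂)
            * (c (LaurentPolynomial.T 2) + c (LaurentPolynomial.T (-2))) := by
  obtain ⟨P, hP, hP0⟩ := exists_inverse_of_quadratic hσ hπ
  have hP' := congrArg invertSer hP
  simp only [map_mul, map_add, map_sub, map_one, invertSer_constSer, invertSer_c_T] at hP'
  -- H = α + (b₁ z + b₂ z²) P(z) + (b₁/z + b₂/z²) P(1/z): the second summand has only positive
  -- powers of z and the third only negative ones.
  refine ⟨constSer α
    + (constSer b₁ * (c (LaurentPolynomial.T 1) * P) + constSer b₂ * (c (LaurentPolynomial.T 2) * P))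
    + (constSer b₁ * (c (LaurentPolynomial.T (-1)) * invertSer P)
      + constSer b₂ * (c (LaurentPolynomial.T (-2)) * invertSer P)), ?_, ?_⟩
  · simp only [map_add, zCoeff_constSer_mul, zCoeff_c_T_mul, zCoeff_invertSer, zCoeff_constSer]
    rw [hP0 _ (by norm_num), hP0 _ (by norm_num), hP0 _ (by norm_num), hP0 _ (by norm_num)]
    simp
  · have h2 : (c (LaurentPolynomial.T 2) : Ser (LaurentPolynomial R))
        = c (LaurentPolynomial.T 1) ^ 2 := by rw [sq, c_T_mul_c_T]; rfl
    have h3 : (c (LaurentPolynomial.T (-2)) : Ser (LaurentPolynomial R))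
        = c (LaurentPolynomial.T (-1)) ^ 2 := by rw [sq, c_T_mul_c_T]; rfl
    have h1 : (c (LaurentPolynomial.T 1) : Ser (LaurentPolynomial R))
        * c (LaurentPolynomial.T (-1)) = 1 := by
      rw [c_T_mul_c_T]
      simp [c]
    rw [h2] at hP
    rw [h3] at hP'
    rw [h2, h3]
    simp only [map_add, map_mul, map_sub, map_neg, map_pow, map_one, map_ofNat]
    generalize (c (LaurentPolynomial.T 1) : Ser (LaurentPolynomial R)) = x at *
    generalize (c (LaurentPolynomial.T (-1)) : Ser (LaurentPolynomial R)) = y at *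
    generalize invertSer P = P' at *
    generalize constSer σ = σ' at *
    generalize constSer π = π' at *
    generalize constSer α = α' at *
    generalize constSer b₁ = β₁ at *
    generalize constSer b₂ = β₂ at *
    linear_combination (β₁ * x + β₂ * x ^ 2) * (1 - σ' * y + π' * y ^ 2) * hP
      + (β₁ * y + β₂ * y ^ 2) * (1 - σ' * x + π' * x ^ 2) * hP'
      + (α' * (σ' ^ 2 - σ' * π' * (x + y) + π' ^ 2 * (x * y + 1)) - 2 * σ' * β₁
        - σ' * β₂ * (x + y) + π' * β₁ * (x + y) + 2 * π' * β₂ * (x * y + 1)) * h1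

end PartialFractions

/-! ### The series `T` and `A` -/

/-- The properties of the series that occur in the expression of `A`, with `e = a - 1`. -/
theorem exists_isT_quadratic : ∃ w V : Ser Qa,
    w ^ 2 = (1 - t ^ 2 - s ^ 2 * (4 - t ^ 2 * c (a - 1) ^ 2)) ^ 2
      - 4 * (t ^ 2 * c (a + 1) ^ 2) * s ^ 2 ∧ constantCoeff w = 1 ∧
    (1 - t ^ 2 - s ^ 2 * (4 - t ^ 2 * c (a - 1) ^ 2) + w) * V = 1 := by
  have h0 : constantCoeff ((1 - t ^ 2 - s ^ 2 * (4 - t ^ 2 * c (a - 1) ^ 2)) ^ 2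
      - 4 * (t ^ 2 * c (a + 1) ^ 2) * s ^ 2 : Ser Qa) = 1 := by
    simp [constantCoeff_s, constantCoeff_t]
  obtain ⟨w, hw, hw1⟩ := exists_isSqrtSeries h0
  -- The factor to be inverted has constant term 2. Inverting it permits writing the root of the
  -- quadratic as 2s²/(β + w), with no division by t²(a + 1)².
  have h2 : IsUnit (2 : Qa) := by
    have : (2 : Qa) = Polynomial.C 2 := (map_ofNat _ _).symm
    rw [this, Polynomial.isUnit_C]
    exact isUnit_iff_ne_zero.mpr two_ne_zero
  refine ⟨w, invOfUnit _ h2.unit, hw, hw1, mul_invOfUnit _ _ ?_⟩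
  simp [constantCoeff_s, constantCoeff_t, hw1]
  norm_num

/-- The quadratic equation of `T`. -/
def IsQuadraticT (T : Ser Qa) : Prop :=
  T * (1 - t ^ 2 - t ^ 2 * c (a + 1) ^ 2 * T) = s ^ 2 * (1 + 4 * T - t ^ 2 * c (a - 1) ^ 2 * T)

theorem constantCoeff_one_sub (T : Ser Qa) :
    constantCoeff (1 - t ^ 2 - t ^ 2 * c (a + 1) ^ 2 * T) = ((1 : Qaˣ) : Qa) := by
  simp [constantCoeff_t]

theorem isT_iff {T : Ser Qa} :
    IsT T ↔ (∀ n : Fin 2 →₀ ℕ, n 0 = 0 → coeff n T = 0) ∧ IsQuadraticT T := by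
  have h := mul_invOfUnit _ _ (constantCoeff_one_sub T)
  refine and_congr_right fun _ => ⟨fun hT => ?_, fun hT => ?_⟩
  · rw [IsQuadraticT]
    linear_combination (1 - t ^ 2 - t ^ 2 * c (a + 1) ^ 2 * T) * hT
      + s ^ 2 * (1 + 4 * T - t ^ 2 * c (a - 1) ^ 2 * T) * h
  · rw [IsQuadraticT] at hT
    linear_combination invOfUnit (1 - t ^ 2 - t ^ 2 * c (a + 1) ^ 2 * T) 1 * hT - T * h

/-- The difference of the two quadratic equations factors as T' - T times a series with constant
term 1. -/
theorem IsT.eq {T T' : Ser Qa} (hT : IsT T) (hT' : IsT T') : T' = T := by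
  obtain ⟨h0, h⟩ := isT_iff.mp hT
  obtain ⟨h0', h'⟩ := isT_iff.mp hT'
  rw [IsQuadraticT] at h h'
  have h1 : (T' - T) * (1 - t ^ 2 - t ^ 2 * c (a + 1) ^ 2 * (T + T')
      - s ^ 2 * (4 - t ^ 2 * c (a - 1) ^ 2)) = 0 := by
    linear_combination h' - h
  refine sub_eq_zero.mp ((mul_eq_zero.mp h1).resolve_right fun h2 => ?_)
  have := congrArg (constantCoeff (σ := Fin 2) (R := Qa)) h2
  simp [constantCoeff_s, constantCoeff_t] at this

theorem coeff_s_mul_of_eq_zero {R : Type} [CommRing R] (F : Ser R) {n : Fin 2 →₀ ℕ} (h : n 0 = 0) :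
    coeff n (s * F) = 0 := by
  classical
  rw [s, X, coeff_monomial_mul, if_neg]
  intro hle
  have := hle 0
  simp [h] at this

theorem cornerDenom_eq :
    (1 - sxx) ^ 2 - t ^ 2 * cornerFactor
      = constSer (1 - t ^ 2 - t ^ 2 * s ^ 2 * c (a - 1) ^ 2 + 2 * s ^ 2)
        + constSer (-(2 * s + t ^ 2 * s * c (a - 1)))
          * (c (LaurentPolynomial.T 1) + c (LaurentPolynomial.T (-1)))
        + constSer (s ^ 2) * (c (LaurentPolynomial.T 2) + c (LaurentPolynomial.T (-2))) := by
  have h1 : (c (LaurentPolynomial.T 1) : Ser Qax) * c (LaurentPolynomial.T (-1)) = 1 := by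
    rw [c_T_mul_c_T]
    simp [c]
  have h2 : (c (LaurentPolynomial.T 2) : Ser Qax) = c (LaurentPolynomial.T 1) ^ 2 := by
    rw [sq, c_T_mul_c_T]; rfl
  have h3 : (c (LaurentPolynomial.T (-2)) : Ser Qax) = c (LaurentPolynomial.T (-1)) ^ 2 := by
    rw [sq, c_T_mul_c_T]; rfl
  have h4 (k : ℤ) : c (xpow k * LaurentPolynomial.C (a - 1))
      = c (LaurentPolynomial.T k) * constSer (c (a - 1)) := by
    rw [constSer_c, c, c, c, ← map_mul]
    rfl
  have h5 : c (xpow 1 + xpow (-1)) = c (LaurentPolynomial.T 1) + c (LaurentPolynomial.T (-1)) := by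
    rw [c, map_add]
    rfl
  rw [cornerFactor, sxx, h2, h3, h4, h4, h5]
  simp only [map_add, map_mul, map_pow, map_sub, map_one, map_ofNat, map_neg, constSer_s,
    constSer_t]
  linear_combination (2 * s ^ 2 - t ^ 2 * s ^ 2 * constSer (c (a - 1)) ^ 2) * h1

theorem symmetric_quadratic_mul {R : Type} [CommRing R] (σ π : Ser R) :
    (1 - constSer σ * c (LaurentPolynomial.T 1) + constSer π * c (LaurentPolynomial.T 2))
      * (1 - constSer σ * c (LaurentPolynomial.T (-1)) + constSer π * c (LaurentPolynomial.T (-2)))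
      = constSer (1 + σ ^ 2 + π ^ 2)
        - constSer (σ * (1 + π)) * (c (LaurentPolynomial.T 1) + c (LaurentPolynomial.T (-1)))
        + constSer π * (c (LaurentPolynomial.T 2) + c (LaurentPolynomial.T (-2))) := by
  have h1 : (c (LaurentPolynomial.T 1) : Ser (LaurentPolynomial R))
      * c (LaurentPolynomial.T (-1)) = 1 := by
    rw [c_T_mul_c_T]
    simp [c]
  have h2 : (c (LaurentPolynomial.T 2) : Ser (LaurentPolynomial R))
      = c (LaurentPolynomial.T 1) ^ 2 := by
    rw [sq, c_T_mul_c_T]; rfl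
  have h3 : (c (LaurentPolynomial.T (-2)) : Ser (LaurentPolynomial R))
      = c (LaurentPolynomial.T (-1)) ^ 2 := by
    rw [sq, c_T_mul_c_T]; rfl
  rw [h2, h3]
  simp only [map_add, map_mul, map_pow, map_one]
  generalize (c (LaurentPolynomial.T 1) : Ser (LaurentPolynomial R)) = x at *
  generalize (c (LaurentPolynomial.T (-1)) : Ser (LaurentPolynomial R)) = y at *
  linear_combination (constSer σ ^ 2 - constSer σ * constSer π * (x + y)
    + constSer π ^ 2 * (x * y + 1)) * h1

/-- `A` is determined by the symmetric factorization of its denominator. -/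
theorem serA_eq_of_factorization {σ ϖ ϖ' α b₁ : Ser Qa} (hσ : constantCoeff σ = 0)
    (hϖ : ϖ * ϖ' = 1)
    (h1 : ϖ * (2 * s + t ^ 2 * s * c (a - 1)) = σ * (1 + s ^ 2 * ϖ))
    (h0 : ϖ * (1 - t ^ 2 - t ^ 2 * s ^ 2 * c (a - 1) ^ 2 + 2 * s ^ 2)
      = 1 + σ ^ 2 + (s ^ 2 * ϖ) ^ 2)
    (hb : b₁ * (1 + s ^ 2 * ϖ) = α * σ - s * ϖ)
    (hα : ϖ = α * (1 + σ ^ 2 - (s ^ 2 * ϖ) ^ 2) - 2 * σ * b₁) : serA = α := by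
  -- The value b₂ = -απ, π = s²ϖ, cancels the terms in x² and x⁻², absent from the target numerator
  -- ϖ(1 - s(x + 1/x)); `hb` and `hα` match the other coefficients.
  obtain ⟨H, hH0, hH⟩ := exists_zCoeff_zero_eq (α := α) (b₁ := b₁) (b₂ := -(α * (s ^ 2 * ϖ))) hσ
    (π := s ^ 2 * ϖ) (by rw [map_mul, map_pow, constantCoeff_s, zero_pow two_ne_zero, zero_mul])
  rw [← hH0]
  have hs : (1 - sxx : Ser Qax)
      = 1 - constSer s * (c (LaurentPolynomial.T 1) + c (LaurentPolynomial.T (-1))) := by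
    rw [sxx, c, map_add, constSer_s]
    rfl
  refine serA_eq_constTerm ?_
  have hϖ' : constSer ϖ * constSer ϖ' = 1 := by rw [← map_mul, hϖ, map_one]
  have hq : constSer ϖ * ((1 - sxx) ^ 2 - t ^ 2 * cornerFactor)
      = (1 - constSer σ * c (LaurentPolynomial.T 1)
          + constSer (s ^ 2 * ϖ) * c (LaurentPolynomial.T 2))
        * (1 - constSer σ * c (LaurentPolynomial.T (-1))
          + constSer (s ^ 2 * ϖ) * c (LaurentPolynomial.T (-2))) := by
    rw [symmetric_quadratic_mul, ← h0, ← h1, cornerDenom_eq]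
    simp only [map_add, map_mul, map_neg, map_sub]
    ring
  have hc0 : α * (1 + σ ^ 2 + (s ^ 2 * ϖ) ^ 2) - 2 * σ * b₁
      + 2 * (s ^ 2 * ϖ) * -(α * (s ^ 2 * ϖ)) = ϖ := by
    linear_combination -hα
  have hc1 : -(α * σ * (1 + s ^ 2 * ϖ)) + b₁ * (1 + s ^ 2 * ϖ) - σ * -(α * (s ^ 2 * ϖ))
      = -(s * ϖ) := by
    linear_combination hb
  rw [← hq, hc0, hc1, add_neg_cancel, map_zero, zero_mul, add_zero, map_neg, map_mul] at hH
  linear_combination constSer ϖ' * hH - hs - (H * ((1 - sxx) ^ 2 - t ^ 2 * cornerFactor)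
    - (1 - constSer s * (c (LaurentPolynomial.T 1) + c (LaurentPolynomial.T (-1))))) * hϖ'

/-- The algebraic identities behind the partial fraction expansion of `A`. -/
theorem partial_fraction_identities {A : Type*} [CommRing A] [IsDomain A]
    {s t e T T' X E K R h H ϖ ϖ' σ α b₁ u δ : A}
    (hT : T = s ^ 2 * T') (hX : X = 1 - t ^ 2 - t ^ 2 * (e + 2) ^ 2 * T)
    (hE : E = 1 + 4 * T - t ^ 2 * e ^ 2 * T) (hXT : X * T' = E) (hX0 : X ≠ 0) (hE0 : E ≠ 0)
    (hK : (1 - t ^ 2 * e ^ 2 * T) * K = 1) (hR : R ^ 2 = E * K) (h4 : (4 : A) ≠ 0)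
    (hh : 2 * h = 1 + R) (hH : h * H = 1) (hϖ : ϖ = T' * K * H ^ 2) (hϖ' : ϖ * ϖ' = 1)
    (hσ : σ * (1 + s ^ 2 * ϖ) = s * ϖ * (2 + t ^ 2 * e))
    (hu : u = 1 - t ^ 2 * e * (e + 2) * T)
    (hδ : δ = (1 - t ^ 2 * e * (e + 2) * T) ^ 2 - t ^ 2 * (1 + 2 * (e + 2) * T) ^ 2)
    (hδ0 : δ ≠ 0) (hα : α * δ = u * R) (hb : b₁ * (1 + s ^ 2 * ϖ) = α * σ - s * ϖ)
    (hY0 : 1 + s ^ 2 * ϖ ≠ 0) :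
    1 + s ^ 2 * ϖ = R * H ∧
    ϖ * (1 - t ^ 2 - t ^ 2 * s ^ 2 * e ^ 2 + 2 * s ^ 2) = 1 + σ ^ 2 + (s ^ 2 * ϖ) ^ 2 ∧
    ϖ = α * (1 + σ ^ 2 - (s ^ 2 * ϖ) ^ 2) - 2 * σ * b₁ := by
  -- With h = (1 + R)/2 this is (R² - 1)/4, and R² - 1 = 4TK. It gives π = s²ϖ = (h - 1)/h, that is
  -- (R - 1)/(R + 1).
  have hhK : h ^ 2 - h = T * K := by
    apply mul_left_cancel₀ h4
    linear_combination (2 * h - 1 + R) * hh + hR + K * hE + hK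
  have hπ : s ^ 2 * ϖ = (h - 1) * H := by
    linear_combination s ^ 2 * hϖ - K * H ^ 2 * hT - H ^ 2 * hhK + (h - 1) * H * hH
  have hY : 1 + s ^ 2 * ϖ = R * H := by linear_combination hπ - hH + H * hh
  have hY' : 1 - s ^ 2 * ϖ = H := by linear_combination -hπ - hH
  have hYX : (1 + s ^ 2 * ϖ) ^ 2 = X * ϖ := by
    rw [hY]
    linear_combination H ^ 2 * hR - K * H ^ 2 * hXT - X * hϖ
  have hσX : σ ^ 2 * X = s ^ 2 * ϖ * (2 + t ^ 2 * e) ^ 2 := by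
    linear_combination ϖ' * (σ * (1 + s ^ 2 * ϖ) + s * ϖ * (2 + t ^ 2 * e)) * hσ
      - ϖ' * σ ^ 2 * hYX
      + (s ^ 2 * ϖ * (2 + t ^ 2 * e) ^ 2 - σ ^ 2 * X) * hϖ'
  -- The quadratic equation of T rewritten for X. With `hσX` and `hYX` it matches the constant
  -- coefficient of the symmetric factorization.
  have hg : X * (1 - t ^ 2 - t ^ 2 * s ^ 2 * e ^ 2 + 4 * s ^ 2 - X)
      = s ^ 2 * (2 + t ^ 2 * e) ^ 2 := by
    linear_combination (-X + (4 - t ^ 2 * e ^ 2) * s ^ 2) * hX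
      + t ^ 2 * (e + 2) ^ 2 * (X * hT + s ^ 2 * hXT + s ^ 2 * hE)
  refine ⟨hY, ?_, ?_⟩
  · apply mul_left_cancel₀ hX0
    linear_combination ϖ * hg - hσX - X * hYX
  · have hmain : R * (X - 2 * s ^ 2 * (2 + t ^ 2 * e))
        = α * (X ^ 2 - s ^ 2 * (2 + t ^ 2 * e) ^ 2) := by
      have hXu : E * (X - 2 * s ^ 2 * (2 + t ^ 2 * e)) = X * u := by
        rw [hu]
        linear_combination X * hE + 2 * (2 + t ^ 2 * e) * X * hT
          + 2 * (2 + t ^ 2 * e) * s ^ 2 * hXT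
      have hXδ : E * (X ^ 2 - s ^ 2 * (2 + t ^ 2 * e) ^ 2) = X * δ := by
        have hδ' : δ = X * E - T * (2 + t ^ 2 * e) ^ 2 := by
          rw [hδ, hX, hE]
          ring
        linear_combination (2 + t ^ 2 * e) ^ 2 * (X * hT + s ^ 2 * hXT) - X * hδ'
      apply mul_left_cancel₀ (mul_ne_zero hE0 hδ0)
      linear_combination R * δ * hXu - u * R * hXδ
        - E * (X ^ 2 - s ^ 2 * (2 + t ^ 2 * e) ^ 2) * hα
    apply mul_left_cancel₀ (mul_ne_zero hX0 (pow_ne_zero 2 hY0))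
    linear_combination 2 * X * (1 + s ^ 2 * ϖ) * σ * hb - 2 * s * ϖ * X * hσ
      + (X * ϖ - α * X * (1 + s ^ 2 * ϖ) * (1 - s ^ 2 * ϖ)
        - ϖ * (X - 2 * s ^ 2 * (2 + t ^ 2 * e))) * hYX
      + α * (1 + s ^ 2 * ϖ) * (1 - s ^ 2 * ϖ) * hσX
      + (1 + s ^ 2 * ϖ) * (1 - s ^ 2 * ϖ) * ϖ * hmain
      + ϖ * (X - 2 * s ^ 2 * (2 + t ^ 2 * e)) * (1 + s ^ 2 * ϖ) * (hY - R * hY')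

theorem c_add_one : c (a + 1) = (c (a - 1) + 2 : Ser Qa) := by
  have h : a + 1 = (a - 1) + 2 := by ring
  rw [h, c, map_add, map_ofNat]
  rfl

theorem c_sq_sub_one : c (a ^ 2 - 1) = (c (a - 1) * (c (a - 1) + 2) : Ser Qa) := by
  have h : a ^ 2 - 1 = (a - 1) * ((a - 1) + 2) := by ring
  rw [h, c, map_mul, map_add, map_ofNat]
  rfl

theorem c_one_sub_sq : c (1 - a ^ 2) = -(c (a - 1) * (c (a - 1) + 2) : Ser Qa) := by
  rw [← c_sq_sub_one, c, c, ← map_neg, neg_sub]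

theorem ne_zero_of_constantCoeff_eq_one {R : Type} [CommRing R] [Nontrivial R] {F : Ser R}
    (h : constantCoeff F = 1) : F ≠ 0 := by
  rintro rfl
  rw [map_zero] at h
  exact zero_ne_one h

theorem exists_inverse_of_constantCoeff {R : Type} [CommRing R] {F : Ser R}
    (h : constantCoeff F = 1) : ∃ G, F * G = 1 ∧ constantCoeff G = 1 := by
  refine ⟨invOfUnit F 1, mul_invOfUnit F 1 (by rw [h, Units.val_one]), ?_⟩
  rw [constantCoeff_invOfUnit, inv_one, Units.val_one]

theorem s_ne_zero : (s : Ser Qa) ≠ 0 := fun h => by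
  have := congrArg (coeff (Finsupp.single 0 1)) h
  rw [s, coeff_index_single_self_X, map_zero] at this
  exact one_ne_zero this

theorem exists_half : ∃ η : Ser Qa, 2 * η = 1 ∧ 2 * constantCoeff η = 1 := by
  have h : (2 : Qa) * Polynomial.C (1 / 2) = 1 := by
    have : (2 : Qa) = Polynomial.C 2 := (map_ofNat _ _).symm
    rw [this, ← map_mul]
    norm_num
  refine ⟨c (Polynomial.C (1 / 2)), ?_, ?_⟩
  · rw [c, ← map_ofNat (C (σ := Fin 2) (R := Qa)) 2, ← map_mul, h, map_one]
  · rw [constantCoeff_c, h]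

/-- The discriminant of the quadratic equation of `T`. -/
def discT : Ser Qa := (1 - t ^ 2 - s ^ 2 * (4 - t ^ 2 * c (a - 1) ^ 2)) ^ 2
  - 4 * (t ^ 2 * c (a + 1) ^ 2) * s ^ 2

theorem exists_serA_formula : ∃ w T R Q : Ser Qa,
    w ^ 2 = discT ∧
    2 * (t ^ 2 * c (a + 1) ^ 2) * T = 1 - t ^ 2 - s ^ 2 * (4 - t ^ 2 * c (a - 1) ^ 2) - w ∧
    IsT T ∧ constantCoeff T = 0 ∧
    Q * (1 - t ^ 2 * c (a - 1) ^ 2 * T) = 1 + 4 * T - t ^ 2 * c (a - 1) ^ 2 * T ∧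
    IsSqrtSeries R Q ∧
    serA * ((1 - t ^ 2 * c (a ^ 2 - 1) * T) ^ 2 - t ^ 2 * (1 + 2 * c (a + 1) * T) ^ 2)
      = (1 + t ^ 2 * c (1 - a ^ 2) * T) * R := by
  obtain ⟨w, V, hw, hw1, hV⟩ := exists_isT_quadratic
  obtain ⟨η, hη, hη1⟩ := exists_half
  have h2 : (2 : Ser Qa) ≠ 0 := by
    intro h
    rw [h, zero_mul] at hη
    exact zero_ne_one hη
  have h4 : (4 : Ser Qa) ≠ 0 := by
    have : (4 : Ser Qa) = 2 * 2 := by norm_num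
    rw [this]
    exact mul_ne_zero h2 h2
  -- The root 2s²/(β + w) is the one divisible by s².
  obtain ⟨T, hT⟩ : ∃ T : Ser Qa, T = s ^ 2 * (2 * V) := ⟨_, rfl⟩
  have hT0 : constantCoeff T = 0 := by
    rw [hT, map_mul, map_pow, constantCoeff_s, zero_pow two_ne_zero, zero_mul]
  have hquad : IsQuadraticT T := by
    rw [IsQuadraticT, hT]
    linear_combination -(s ^ 2 * V ^ 2) * hw - s ^ 2 * ((1 - t ^ 2 - s ^ 2 * (4 - t ^ 2 * c (a - 1) ^ 2)
      - w) * V - 1) * hV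
  have hIsT : IsT T := by
    refine isT_iff.mpr ⟨fun n hn => ?_, hquad⟩
    rw [hT, sq, mul_assoc]
    exact coeff_s_mul_of_eq_zero _ hn
  have hwT : 2 * (t ^ 2 * c (a + 1) ^ 2) * T
      = 1 - t ^ 2 - s ^ 2 * (4 - t ^ 2 * c (a - 1) ^ 2) - w := by
    rw [hT]
    linear_combination (1 - t ^ 2 - s ^ 2 * (4 - t ^ 2 * c (a - 1) ^ 2) - w) * hV + V * hw
  rw [IsQuadraticT] at hquad
  have hn1 : constantCoeff (1 - t ^ 2 * c (a - 1) ^ 2 * T) = 1 := by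
    rw [map_sub, map_mul, hT0, mul_zero, map_one, sub_zero]
  obtain ⟨K, hK, hK1⟩ := exists_inverse_of_constantCoeff hn1
  obtain ⟨E, hE⟩ : ∃ E : Ser Qa, E = 1 + 4 * T - t ^ 2 * c (a - 1) ^ 2 * T := ⟨_, rfl⟩
  have hE1 : constantCoeff E = 1 := by
    rw [hE, map_sub, map_add, map_mul, map_mul, hT0, mul_zero, mul_zero, map_one, add_zero, sub_zero]
  have hQ1 : constantCoeff (E * K) = 1 := by rw [map_mul, hE1, hK1, mul_one]
  obtain ⟨R, hR, hR1⟩ := exists_isSqrtSeries hQ1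
  refine ⟨w, T, R, E * K, hw, hwT, hIsT, hT0, by linear_combination E * hK + hE, ⟨hR, hR1⟩, ?_⟩
  obtain ⟨X, hX⟩ : ∃ X : Ser Qa, X = 1 - t ^ 2 - t ^ 2 * c (a + 1) ^ 2 * T := ⟨_, rfl⟩
  have hX1 : constantCoeff X = 1 := hX ▸ constantCoeff_one_sub T
  have hs0 : (s ^ 2 : Ser Qa) ≠ 0 := pow_ne_zero 2 s_ne_zero
  have hXT : X * (2 * V) = E := by
    apply mul_left_cancel₀ hs0
    linear_combination hquad - X * hT + T * hX - s ^ 2 * hE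
  have hh1 : constantCoeff (η * (1 + R)) = 1 := by
    rw [map_mul, map_add, map_one, hR1]
    linear_combination hη1
  obtain ⟨H, hH, hH1⟩ := exists_inverse_of_constantCoeff hh1
  obtain ⟨Ri, hRi, -⟩ := exists_inverse_of_constantCoeff hR1
  have hV1 : constantCoeff (2 * V) = 1 := by
    have := congrArg (constantCoeff (σ := Fin 2) (R := Qa)) hXT
    rwa [map_mul, hX1, one_mul, hE1] at this
  have hϖ1 : constantCoeff (2 * V * K * H ^ 2) = 1 := by
    rw [map_mul, map_mul, hV1, hK1, map_pow, hH1]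
    norm_num
  obtain ⟨ϖ', hϖ', -⟩ := exists_inverse_of_constantCoeff hϖ1
  set ϖ : Ser Qa := 2 * V * K * H ^ 2 with hϖ
  have hY1 : constantCoeff (1 + s ^ 2 * ϖ) = 1 := by
    rw [map_add, map_mul, map_pow, constantCoeff_s, zero_pow two_ne_zero, zero_mul, map_one,
      add_zero]
  obtain ⟨Y', hY', -⟩ := exists_inverse_of_constantCoeff hY1
  have hδ1 : constantCoeff ((1 - t ^ 2 * c (a - 1) * (c (a - 1) + 2) * T) ^ 2
      - t ^ 2 * (1 + 2 * (c (a - 1) + 2) * T) ^ 2) = 1 := by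
    rw [map_sub, map_pow, map_sub, map_mul _ _ T, hT0, mul_zero, map_one, map_mul _ (t ^ 2), map_pow,
      constantCoeff_t, zero_pow two_ne_zero, zero_mul]
    norm_num
  obtain ⟨δ', hδ', -⟩ := exists_inverse_of_constantCoeff hδ1
  set u : Ser Qa := 1 - t ^ 2 * c (a - 1) * (c (a - 1) + 2) * T with hu
  set δ : Ser Qa := u ^ 2 - t ^ 2 * (1 + 2 * (c (a - 1) + 2) * T) ^ 2 with hδ
  have : IsDomain (Ser Qa) := NoZeroDivisors.to_isDomain _
  obtain ⟨-, hid0, hid1⟩ := partial_fraction_identities (s := s) (t := t) (e := c (a - 1)) (T := T)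
    (T' := 2 * V) (X := X) (E := E) (K := K) (R := R) (h := η * (1 + R)) (H := H) (ϖ := ϖ) (ϖ' := ϖ')
    (σ := s * ϖ * (2 + t ^ 2 * c (a - 1)) * Y') (α := u * R * δ')
    (b₁ := (u * R * δ' * (s * ϖ * (2 + t ^ 2 * c (a - 1)) * Y') - s * ϖ) * Y') (u := u) (δ := δ)
    hT (by rw [hX, c_add_one]) hE hXT (ne_zero_of_constantCoeff_eq_one hX1)
    (ne_zero_of_constantCoeff_eq_one hE1) hK hR h4 (by linear_combination (1 + R) * hη) hH hϖ hϖ'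
    (by linear_combination s * ϖ * (2 + t ^ 2 * c (a - 1)) * hY') hu hδ
    (ne_zero_of_constantCoeff_eq_one hδ1) (by linear_combination u * R * hδ')
    (by linear_combination (u * R * δ' * (s * ϖ * (2 + t ^ 2 * c (a - 1)) * Y') - s * ϖ) * hY')
    (ne_zero_of_constantCoeff_eq_one hY1)
  have hA : serA = u * R * δ' := by
    refine serA_eq_of_factorization (σ := s * ϖ * (2 + t ^ 2 * c (a - 1)) * Y') ?_ hϖ' ?_ hid0 ?_ hid1
    · simp only [map_mul, constantCoeff_s, zero_mul]
    · linear_combination -(s * ϖ * (2 + t ^ 2 * c (a - 1))) * hY'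
    · linear_combination
        (u * R * δ' * (s * ϖ * (2 + t ^ 2 * c (a - 1)) * Y') - s * ϖ) * hY'
  rw [hA, c_sq_sub_one, c_add_one, c_one_sub_sq]
  linear_combination u * R * hδ'

/-! ### Degree of `A` -/

/-- If p ≠ 0, then p² ∣ q² gives p ∣ q in an integrally closed domain, and (q/p)² = δ. -/
theorem eq_zero_of_mul_sq_eq_sq {P : Type*} [CommRing P] [IsDomain P] [IsIntegrallyClosed P] {δ : P}
    (hδ : ∀ r, r ^ 2 ≠ δ) {p q : P} (h : δ * p ^ 2 = q ^ 2) : p = 0 := by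
  by_contra hp
  have hdvd : p ∣ q := by
    rw [← IsIntegrallyClosed.pow_dvd_pow_iff two_ne_zero, ← h]
    exact dvd_mul_left _ _
  obtain ⟨r, rfl⟩ := hdvd
  refine hδ r (mul_right_cancel₀ (pow_ne_zero 2 hp) ?_)
  rw [h]
  ring

/-! ### Square roots over a quadratic extension -/

section Biquadratic

variable {P S : Type*} [CommRing P] [CommRing S] [Algebra P S]

/-- The evaluation `u + v ω ↦ u + v w`. -/
def evalOmega {d : P} {w : S} (hw : w ^ 2 = algebraMap P S d) : QuadraticAlgebra P d 0 →ₐ[P] S :=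
  QuadraticAlgebra.lift ⟨w, by rw [← sq, hw, zero_smul, add_zero, Algebra.algebraMap_eq_smul_one]⟩

theorem evalOmega_apply {d : P} {w : S} (hw : w ^ 2 = algebraMap P S d)
    (z : QuadraticAlgebra P d 0) :
    evalOmega hw z = algebraMap P S z.re + algebraMap P S z.im * w := by
  rw [Algebra.algebraMap_eq_smul_one, ← Algebra.smul_def]
  rfl

theorem quadraticAlgebra_norm_eq {d : P} (z : QuadraticAlgebra P d 0) :
    z.norm = z.re ^ 2 - d * z.im ^ 2 := by
  rw [QuadraticAlgebra.norm_def]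
  ring

theorem quadraticAlgebra_norm_algebraMap_add {d : P} (p q b : P) :
    (algebraMap P (QuadraticAlgebra P d 0) p + algebraMap P (QuadraticAlgebra P d 0) q
      * ⟨b, -1⟩).norm = (p + q * b) ^ 2 - d * q ^ 2 := by
  rw [quadraticAlgebra_norm_eq]
  simp [QuadraticAlgebra.algebraMap_eq]

theorem eq_zero_of_norm_eq_zero [IsDomain P] {d : P} (hd : ∀ x y : P, d * y ^ 2 = x ^ 2 → y = 0)
    {z : QuadraticAlgebra P d 0} (h : z.norm = 0) : z = 0 := by
  rw [quadraticAlgebra_norm_eq] at h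
  have h1 := hd z.re z.im (sub_eq_zero.mp h).symm
  rw [h1, zero_pow two_ne_zero, mul_zero, sub_zero] at h
  exact QuadraticAlgebra.ext (eq_zero_of_pow_eq_zero h) h1

theorem evalOmega_injective [IsDomain P] {d : P} {w : S} (hw : w ^ 2 = algebraMap P S d)
    (hinj : Function.Injective (algebraMap P S)) (hd : ∀ x y : P, d * y ^ 2 = x ^ 2 → y = 0) :
    Function.Injective (evalOmega hw) := by
  refine (injective_iff_map_eq_zero _).mpr fun z hz => ?_
  rw [evalOmega_apply] at hz
  apply eq_zero_of_norm_eq_zero hd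
  apply hinj
  rw [quadraticAlgebra_norm_eq, map_sub, map_mul, map_pow, map_pow, map_zero, ← hw]
  linear_combination (algebraMap P S z.re - algebraMap P S z.im * w) * hz

/-- A square root of an element of a quadratic extension has degree four, if the norm of this
element is not a square. -/
theorem biquadratic_of_norm [IsDomain P] {d : P} {w A : S} (hw : w ^ 2 = algebraMap P S d)
    (hinj : Function.Injective (algebraMap P S)) (hd : ∀ x y : P, d * y ^ 2 = x ^ 2 → y = 0)
    {U V : QuadraticAlgebra P d 0} (hA : A ^ 2 * evalOmega hw U = evalOmega hw V)
    (hUV : ∀ x y : P, U.norm * x ^ 2 = V.norm * y ^ 2 → x = 0 ∧ y = 0) :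
    (∃ c₀ c₁ c₂ : P, c₂ ≠ 0 ∧
      algebraMap P S c₂ * A ^ 4 + algebraMap P S c₁ * A ^ 2 + algebraMap P S c₀ = 0) ∧
    ∀ p : Polynomial P, p ≠ 0 → Polynomial.aeval A p = 0 → 4 ≤ p.natDegree := by
  have hU0 : U.norm ≠ 0 := fun h =>
    one_ne_zero (hUV 1 0 (by rw [h, zero_mul, zero_pow two_ne_zero, mul_zero])).1
  have hψ := evalOmega_injective hw hinj hd
  have hpair (x y : P) (h : algebraMap P S x * evalOmega hw U + algebraMap P S y * evalOmega hw V = 0) :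
      x = 0 ∧ y = 0 := by
    have h1 : algebraMap P _ x * U = -(algebraMap P _ y * V) := by
      apply hψ
      rw [map_neg, map_mul, map_mul, AlgHom.commutes, AlgHom.commutes]
      linear_combination h
    have h2 := congrArg QuadraticAlgebra.norm h1
    rw [QuadraticAlgebra.norm_neg, map_mul, map_mul, QuadraticAlgebra.norm_algebraMap,
      QuadraticAlgebra.norm_algebraMap] at h2
    exact hUV x y (by linear_combination h2)
  refine ⟨?_, fun p hp hpA => ?_⟩
  · have h1 := congrArg (evalOmega hw) (QuadraticAlgebra.algebraMap_norm_eq_mul_star U)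
    rw [AlgHom.commutes, map_mul] at h1
    have h2 := evalOmega_apply hw (V * star U)
    rw [map_mul] at h2
    -- From N(U) A² = v₀ + v₁ w, squaring N(U) A² - v₀ = v₁ w eliminates w.
    refine ⟨(V * star U).re ^ 2 - d * (V * star U).im ^ 2, -2 * (V * star U).re * U.norm, U.norm ^ 2,
      pow_ne_zero 2 hU0, ?_⟩
    simp only [map_sub, map_mul, map_pow, map_neg, map_ofNat, ← hw, h1]
    generalize algebraMap P S (V * star U).re = v₀ at *
    generalize algebraMap P S (V * star U).im = v₁ at *
    generalize evalOmega hw (star U) = U' at *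
    generalize evalOmega hw U = U₁ at *
    generalize evalOmega hw V = V₁ at *
    linear_combination (A ^ 2 * U₁ * U' - v₀ + v₁ * w) * (U' * hA + h2)
  · by_contra hlt
    push Not at hlt
    rw [Polynomial.aeval_eq_sum_range' hlt] at hpA
    simp only [Finset.sum_range_succ, Finset.sum_range_zero, Algebra.smul_def, zero_add, pow_zero,
      mul_one, pow_one] at hpA
    -- Split a relation of degree at most 3 into odd and even powers of A and clear A² = V/U, giving
    -- A g = h with g, h in the quadratic extension.
    have h3 : A * evalOmega hw (algebraMap P _ (p.coeff 1) * U + algebraMap P _ (p.coeff 3) * V)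
        = evalOmega hw (-(algebraMap P _ (p.coeff 0) * U + algebraMap P _ (p.coeff 2) * V)) := by
      simp only [map_add, map_mul, map_neg, AlgHom.commutes]
      linear_combination evalOmega hw U * hpA - (algebraMap P S (p.coeff 2)
        + algebraMap P S (p.coeff 3) * A) * hA
    generalize hg : algebraMap P _ (p.coeff 1) * U + algebraMap P _ (p.coeff 3) * V = g at h3
    generalize hh : -(algebraMap P _ (p.coeff 0) * U + algebraMap P _ (p.coeff 2) * V) = h at h3
    have h4 : U * h ^ 2 = V * g ^ 2 := by
      apply hψ
      rw [map_mul, map_mul, map_pow, map_pow, ← h3]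
      linear_combination (evalOmega hw g) ^ 2 * hA
    -- Norms of U h² = V g² give N(U) N(h)² = N(V) N(g)², so g = h = 0; applying norms again to
    -- these two equations kills all four coefficients.
    have h5 := congrArg QuadraticAlgebra.norm h4
    rw [map_mul, map_mul, map_pow, map_pow] at h5
    obtain ⟨h6, h7⟩ := hUV _ _ h5
    have h8 := congrArg (evalOmega hw) (hg.trans (eq_zero_of_norm_eq_zero hd h7))
    have h9 := congrArg (evalOmega hw) (hh.trans (eq_zero_of_norm_eq_zero hd h6))
    simp only [map_add, map_mul, map_neg, AlgHom.commutes, map_zero, neg_eq_zero] at h8 h9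
    obtain ⟨hp1, hp3⟩ := hpair _ _ h8
    obtain ⟨hp0, hp2⟩ := hpair _ _ h9
    refine hp (Polynomial.ext fun i => ?_)
    rw [Polynomial.coeff_zero]
    rcases lt_or_ge i 4 with hi | hi
    · interval_cases i <;> assumption
    · exact Polynomial.coeff_eq_zero_of_natDegree_lt (by omega)

end Biquadratic

/-! ### Nonsquares by specialization, and the degree of A -/

/-- The evaluation of a polynomial in `a, s, t`. -/
def evalPol (a₀ s₀ t₀ : ℚ) : Pol Qa →+* ℚ :=
  MvPolynomial.eval₂Hom (Polynomial.evalRingHom a₀) ![s₀, t₀]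

theorem ne_sq_of_evalPol_neg {δ : Pol Qa} {a₀ s₀ t₀ : ℚ} (h : evalPol a₀ s₀ t₀ δ < 0) (r : Pol Qa) :
    r ^ 2 ≠ δ := by
  rintro rfl
  rw [map_pow] at h
  exact absurd h (not_lt.mpr (sq_nonneg _))

theorem isBiquadratic_serA : IsBiquadratic serA := by
  obtain ⟨w, T, R, Q, hw, hT, -, hT0, hQ, ⟨hR, -⟩, hA⟩ := exists_serA_formula
  set s' : Pol Qa := MvPolynomial.X 0 with hs'
  set t' : Pol Qa := MvPolynomial.X 1 with ht'
  set e : Pol Qa := MvPolynomial.C (a - 1) with he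
  set α : Pol Qa := t' ^ 2 * (e + 2) ^ 2 with hα
  set β : Pol Qa := 1 - t' ^ 2 - s' ^ 2 * (4 - t' ^ 2 * e ^ 2) with hβ
  have es : algebraMap (Pol Qa) (Ser Qa) s' = s := MvPolynomial.coe_X 0
  have et : algebraMap (Pol Qa) (Ser Qa) t' = t := MvPolynomial.coe_X 1
  have ee : algebraMap (Pol Qa) (Ser Qa) e = c (a - 1) := MvPolynomial.coe_C _
  have vs (x y z : ℚ) : evalPol x y z s' = y := by simp [evalPol, hs']
  have vt (x y z : ℚ) : evalPol x y z t' = z := by simp [evalPol, ht']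
  have ve (x y z : ℚ) : evalPol x y z e = x - 1 := by simp [evalPol, he, a]
  have hinj : Function.Injective (algebraMap (Pol Qa) (Ser Qa)) :=
    MvPolynomial.coe_injective (σ := Fin 2) (R := Qa)
  have hw' : w ^ 2 = algebraMap (Pol Qa) (Ser Qa) (β ^ 2 - 4 * α * s' ^ 2) := by
    rw [hw, discT, c_add_one]
    simp only [hα, hβ, map_sub, map_mul, map_pow, map_add, map_one, map_ofNat, es, et, ee]
  have hd : ∀ x y : Pol Qa, (β ^ 2 - 4 * α * s' ^ 2) * y ^ 2 = x ^ 2 → y = 0 := fun x y h => by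
    -- At this point α = 16 and β = -7, so the discriminant is 49 - 64 < 0.
    refine eq_zero_of_mul_sq_eq_sq (ne_sq_of_evalPol_neg (a₀ := 1) (s₀ := 1) (t₀ := 2) ?_) h
    simp only [hα, hβ, map_sub, map_mul, map_pow, map_add, map_one, map_ofNat, vs, vt, ve]
    norm_num
  have ne_zero_of_eval (x y z : ℚ) (p : Pol Qa) (h : evalPol x y z p ≠ 0) : p ≠ 0 := fun h0 =>
    h (by rw [h0, map_zero])
  obtain ⟨α₂, hα₂⟩ : ∃ α₂, α₂ = 2 * α := ⟨_, rfl⟩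
  have hα0 : α₂ ≠ 0 := ne_zero_of_eval 1 1 1 _ (by
    simp only [hα₂, hα, map_mul, map_pow, map_add, map_ofNat, vt, ve]
    norm_num)
  have ht0 : t' ≠ 0 := ne_zero_of_eval 1 1 1 _ (by rw [vt]; exact one_ne_zero)
  have hκ0 : 2 + t' ^ 2 * e ≠ 0 := ne_zero_of_eval 1 1 1 _ (by
    simp only [map_mul, map_pow, map_add, map_ofNat, vt, ve]
    norm_num)
  have hδ {x y : Pol Qa} (h : (4 * (e + 1) + t' ^ 2 * e ^ 2 + 4 * s' ^ 2 * e ^ 2) * x ^ 2 = y ^ 2) :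
      x = 0 := by
    -- Here e = -2 and the value is 4(e + 1) = -4.
    refine eq_zero_of_mul_sq_eq_sq (ne_sq_of_evalPol_neg (a₀ := -1) (s₀ := 0) (t₀ := 0) ?_) h
    simp only [map_mul, map_pow, map_add, map_one, map_ofNat, vs, vt, ve]
    norm_num
  set M := QuadraticAlgebra (Pol Qa) (β ^ 2 - 4 * α * s' ^ 2) 0 with hM
  set ι : Pol Qa →+* M := algebraMap _ _ with hι
  have hψι (p : Pol Qa) : evalOmega hw' (ι p) = algebraMap (Pol Qa) (Ser Qa) p :=
    AlgHom.commutes _ _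
  have eα : algebraMap (Pol Qa) (Ser Qa) α = t ^ 2 * (c (a - 1) + 2) ^ 2 := by
    simp only [hα, map_mul, map_pow, map_add, map_ofNat, et, ee]
  have eβ : algebraMap (Pol Qa) (Ser Qa) β = 1 - t ^ 2 - s ^ 2 * (4 - t ^ 2 * c (a - 1) ^ 2) := by
    simp only [hβ, map_mul, map_pow, map_sub, map_one, map_ofNat, et, ee, es]
  rw [c_sq_sub_one, c_one_sub_sq] at hA
  rw [c_add_one] at hA hT
  rw [← eα, ← eβ] at hT
  -- The element β - ω represents 2αT. Since T itself is not available with polynomial coefficients,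
  -- z₁, ..., z₄ below are the factors of the formula for A cleared of denominators by powers of α₂
  -- = 2α.
  obtain ⟨τ, hτ⟩ : ∃ τ : M, τ = ⟨β, -1⟩ := ⟨_, rfl⟩
  have hψτ : evalOmega hw' τ = algebraMap (Pol Qa) (Ser Qa) α₂ * T := by
    rw [evalOmega_apply, hτ, map_neg, map_one, hα₂, map_mul, map_ofNat]
    linear_combination -hT
  obtain ⟨z₁, hz₁⟩ : ∃ z : M, z = (ι α₂ - ι (t' ^ 2 * e * (e + 2)) * τ) ^ 2
      - ι (t' ^ 2) * (ι α₂ + ι (2 * (e + 2)) * τ) ^ 2 := ⟨_, rfl⟩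
  obtain ⟨z₂, hz₂⟩ : ∃ z : M, z = ι α₂ * (ι α₂ - ι (t' ^ 2 * e * (e + 2)) * τ) :=
    ⟨_, rfl⟩
  obtain ⟨z₃, hz₃⟩ : ∃ z : M, z = ι α₂ + ι (-(t' ^ 2 * e ^ 2)) * τ := ⟨_, rfl⟩
  obtain ⟨z₄, hz₄⟩ : ∃ z : M, z = ι α₂ + ι (4 - t' ^ 2 * e ^ 2) * τ := ⟨_, rfl⟩
  have hα0' : algebraMap (Pol Qa) (Ser Qa) α₂ ≠ 0 := by
    rw [← map_zero (algebraMap (Pol Qa) (Ser Qa))]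
    exact fun h => hα0 (hinj h)
  have hψz₁ : evalOmega hw' z₁ = algebraMap (Pol Qa) (Ser Qa) α₂ ^ 2
      * ((1 - t ^ 2 * (c (a - 1) * (c (a - 1) + 2)) * T) ^ 2
        - t ^ 2 * (1 + 2 * (c (a - 1) + 2) * T) ^ 2) := by
    rw [hz₁, map_sub, map_mul _ (ι (t' ^ 2)), map_pow _ (_ + _), map_pow _ (_ - _), map_sub,
      map_add, map_mul _ _ τ, map_mul _ _ τ, hψτ, hψι, hψι, hψι, hψι]
    generalize algebraMap (Pol Qa) (Ser Qa) α₂ = k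
    simp only [map_mul, map_pow, map_add, map_ofNat, et, ee]
    ring
  have hψz₂ : evalOmega hw' z₂ = algebraMap (Pol Qa) (Ser Qa) α₂ ^ 2
      * (1 - t ^ 2 * (c (a - 1) * (c (a - 1) + 2)) * T) := by
    rw [hz₂, map_mul _ (ι α₂), map_sub, map_mul _ _ τ, hψτ, hψι, hψι]
    generalize algebraMap (Pol Qa) (Ser Qa) α₂ = k
    simp only [map_mul, map_pow, map_add, map_ofNat, et, ee]
    ring
  have hψz₃ : evalOmega hw' z₃ = algebraMap (Pol Qa) (Ser Qa) α₂
      * (1 - t ^ 2 * c (a - 1) ^ 2 * T) := by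
    rw [hz₃, map_add, map_mul _ _ τ, hψτ, hψι, hψι]
    generalize algebraMap (Pol Qa) (Ser Qa) α₂ = k
    simp only [map_neg, map_mul, map_pow, et, ee]
    ring
  have hψz₄ : evalOmega hw' z₄ = algebraMap (Pol Qa) (Ser Qa) α₂
      * (1 + 4 * T - t ^ 2 * c (a - 1) ^ 2 * T) := by
    rw [hz₄, map_add, map_mul _ _ τ, hψτ, hψι, hψι]
    generalize algebraMap (Pol Qa) (Ser Qa) α₂ = k
    simp only [map_mul, map_pow, map_sub, map_ofNat, et, ee]
    ring
  have norm_ne_zero {z : M} (h : evalOmega hw' z ≠ 0) : z.norm ≠ 0 := fun h0 =>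
    h (by rw [eq_zero_of_norm_eq_zero hd h0, map_zero])
  have hNz₁ : z₁.norm ≠ 0 := by
    refine norm_ne_zero (hψz₁ ▸ mul_ne_zero (pow_ne_zero 2 hα0')
      (ne_zero_of_constantCoeff_eq_one ?_))
    rw [map_sub, map_pow, map_sub, map_mul _ _ T, hT0, mul_zero, map_one, map_mul _ (t ^ 2), map_pow,
      constantCoeff_t, zero_pow two_ne_zero, zero_mul, sub_zero, sub_zero, one_pow]
  have hNz₂ : z₂.norm ≠ 0 := by
    refine norm_ne_zero (hψz₂ ▸ mul_ne_zero (pow_ne_zero 2 hα0')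
      (ne_zero_of_constantCoeff_eq_one ?_))
    rw [map_sub, map_mul _ _ T, hT0, mul_zero, map_one, sub_zero]
  -- The norms of z₃ and z₄ share the factor 2α₂; beyond it z₄ contributes a square, and z₃ a square
  -- times the polynomial shown above to be a nonsquare.
  have hNz₃ : z₃.norm = 2 * α₂ * (4 * (e + 1) + t' ^ 2 * e ^ 2 + 4 * s' ^ 2 * e ^ 2)
      * t' ^ 2 := by
    rw [hz₃, hτ, hι, quadraticAlgebra_norm_algebraMap_add, hα₂, hα, hβ]
    ring
  have hNz₄ : z₄.norm = 2 * α₂ * (2 + t' ^ 2 * e) ^ 2 := by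
    rw [hz₄, hτ, hι, quadraticAlgebra_norm_algebraMap_add, hα₂, hα, hβ]
    ring
  have h2α0 : 2 * α₂ ≠ 0 := mul_ne_zero (left_ne_zero_of_mul (hα₂ ▸ hα0)) hα0
  refine biquadratic_of_norm (U := z₁ ^ 2 * z₃) (V := z₂ ^ 2 * z₄) hw' hinj hd ?_ fun x y h => ?_
  · rw [map_mul, map_mul, map_pow, map_pow, hψz₁, hψz₂, hψz₃, hψz₄]
    generalize algebraMap (Pol Qa) (Ser Qa) α₂ = k
    linear_combination k ^ 5 * ((1 - t ^ 2 * c (a - 1) ^ 2 * T)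
      * (serA * ((1 - t ^ 2 * (c (a - 1) * (c (a - 1) + 2)) * T) ^ 2
          - t ^ 2 * (1 + 2 * (c (a - 1) + 2) * T) ^ 2)
        + (1 - t ^ 2 * (c (a - 1) * (c (a - 1) + 2)) * T) * R) * hA
      + (1 - t ^ 2 * (c (a - 1) * (c (a - 1) + 2)) * T) ^ 2
        * ((1 - t ^ 2 * c (a - 1) ^ 2 * T) * hR + hQ))
  · rw [map_mul, map_mul, map_pow, map_pow, hNz₃, hNz₄] at h
    have h1 : (4 * (e + 1) + t' ^ 2 * e ^ 2 + 4 * s' ^ 2 * e ^ 2) * (z₁.norm * t' * x) ^ 2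
        = (z₂.norm * (2 + t' ^ 2 * e) * y) ^ 2 := by
      apply mul_left_cancel₀ h2α0
      linear_combination h
    have hx := (mul_eq_zero.mp (hδ h1)).resolve_left (mul_ne_zero hNz₁ ht0)
    rw [hx, mul_zero, zero_pow two_ne_zero, mul_zero] at h1
    exact ⟨hx, (mul_eq_zero.mp (eq_zero_of_pow_eq_zero h1.symm)).resolve_left
      (mul_ne_zero hNz₂ hκ0)⟩

end

end SquareLattice

theorem mainTheorem10 :
    -- all walks: `𝒲 = 1 / (1 - s(x+x⁻¹) - t(y+y⁻¹) - st(a-1)(xy⁻¹+x⁻¹y))`, a rational series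
    (gfAll * denomAll = 1 ∧
      IsRationalSeries gfAll) ∧
    -- walks ending on the `x`-axis
    (gfAxis = constTerm gfAll ∧
      IsAlgebraicSeries gfAxis ∧
      ∃ R : Ser Qax,
        IsSqrtSeries R discAxis ∧ gfAxis * R = 1) ∧
    -- loops
    (gfLoop
        = constTerm (constTerm gfAll) ∧
      IsDFinite gfLoop ∧
      gfLoop = sumTSq
        (fun j => ((2 * j).choose j : Ser Qa) * W00 j)) ∧
    -- the series `A`
    (IsBiquadratic serA ∧
      ∃ T : Ser Qa,
        IsT T ∧ (∀ T', IsT T' → T' = T) ∧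
        ∃ R Q : Ser Qa,
          -- `R = √(Q)`, `Q = (1 + 4T - t²(a-1)²T) / (1 - t²(a-1)²T)`
          Q * (1 - t ^ 2 * c (a - 1) ^ 2 * T)
            = 1 + 4 * T - t ^ 2 * c (a - 1) ^ 2 * T ∧
          IsSqrtSeries R Q ∧
          serA *
              ((1 - t ^ 2 * c (a ^ 2 - 1) * T) ^ 2
                - t ^ 2
                  * (1 + 2 * c (a + 1) * T) ^ 2)
            = (1 + t ^ 2 * c (1 - a ^ 2) * T) * R) := by
  obtain ⟨_, T, R, Q, -, -, hT, -, hQ, hR, hA⟩ := exists_serA_formula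
  exact ⟨⟨gfAll_mul_denomAll, isRationalSeries_gfAll⟩,
    ⟨gfAxis_eq_constTerm, isAlgebraicSeries_gfAxis, exists_gfAxis_mul_eq_one⟩,
    ⟨gfAxis_eq_constTerm ▸ gfLoop_eq_constTerm, isDFinite_gfLoop, gfLoop_eq_sumTSq⟩,
    isBiquadratic_serA, T, hT, fun _ => hT.eq, R, Q, hQ, hR, hA⟩
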